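/- Let $d\ge 1$ and let $X_n,Y_n$ ($n\in\mathbb Z^d$) be complex Hilbert spaces; let $\ell^p(X)$, $\ell^p(Y)$ ($1\le p\le\infty$) be the spaces of sequences $x=(x_n)$ with $x_n\in X_n$ (resp. $x_n\in Y_n$) and $\|x\|_p=(\sum_n\|x_n\|^p)^{1/p}<\infty$ (for $p=\infty$: $\sup_n\|x_n\|<\infty$). A matrix $\mathbb A=(a_{mn})_{m,n\in\mathbb Z^d}$ of bounded operators $a_{mn}:X_n\to Y_m$ acts by $(\mathbb Ax)_m=\sum_n a_{mn}x_n$. For real $\alpha\ne0$ and $j\in\mathbb Z^d$, the $j$-th $\alpha$-slant $A_j$ of $\mathbb A$ is the matrix obtained from $\mathbb A$ by replacing by $0$ every entry $a_{mn}$ for which $\alpha m_k-n_k\in[j_k,j_k+1)$ fails for some $k=1,\dots,d$. Put $\|\mathbb A\|_{\sup}=\sup_{m,n}\|a_{mn}\|$ and, for a weight $\omega:\mathbb Z^d\to[1,\infty)$, $$\|\mathbb A\|_{\Sigma^\omega_\alpha}=\lceil|\alpha^{-1}|\rceil^d\sum_{j\in\mathbb Z^d}\|A_j\|_{\sup}\,\omega(j).$$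 $\Sigma^\omega_\alpha$ is the class of matrices with $\|\mathbb A\|_{\Sigma^\omega_\alpha}<\infty$, and $\Sigma_\alpha=\Sigma^1_\alpha$. $\mathcal E_\alpha$ is the class of $\mathbb A\in\Sigma_\alpha$ for which there are $C\in\mathbb R$ and $\tau\in(0,1)$ with $\|A_j\|_{\Sigma_\alpha}\le C\tau^{|j|}$ for all $j$, where $|j|=\max_k|j_k|$. For matrices of operators $Y_m\to X_n$ the classes are defined in the same way. These matrices define bounded operators between the $\ell^p$ spaces for all $p\in[1,\infty]$. Let $\omega$ be a weight that is - admissible: $\omega(-n)=\omega(n)$, and for some $C>0$, $\omega(m+n)\le C\omega(m)\omega(n)$ for all $m,n$; - balanced: $\sup_n\omega(kn)/\omega(n)<\infty$ for every $k\in\mathbb N$; - a GRS-weight: $\lim_{m\to\infty}\omega(mn)^{1/m}=1$ for every $n\in\mathbb Z^d$; and suppose that the balance condition also holds for dilation by $\alpha^{-1}$: $\sup_n\omega(\lceil\alpha^{-1}n\rceil)/\omega(n)<\infty$, with $\lceil\cdot\rceil$ taken coordinatewise (given the other three conditions, this is automatic when $\alpha^{-1}$ is an integer). **Theorem.** Let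 $\mathbb A\in\Sigma^\omega_\alpha$. If $\mathbb A:\ell^p(X)\to\ell^p(Y)$ is invertible (with bounded inverse) for some $p\in[1,\infty]$, then $\mathbb A:\ell^q(X)\to\ell^q(Y)$ is invertible for all $q\in[1,\infty]$, and the inverses are all given by one and the same matrix $\mathbb A^{-1}\in\Sigma^\omega_{\alpha^{-1}}$. If, moreover, $\mathbb A\in\mathcal E_\alpha$, then $\mathbb A^{-1}\in\mathcal E_{\alpha^{-1}}$. -/

import Mathlib

open scoped ENNReal Topology

noncomputable section

namespace Slanted

variable {d : ℕ}

/-! ### Weights on `ℤ^d` -/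

/-- A weight is a function `ω : ℤ^d → [1, ∞)`. -/
def IsWeight (ω : (Fin d → ℤ) → ℝ) : Prop :=
  ∀ n, 1 ≤ ω n

/-- `ω (m + n) ≤ C ω(m) ω(n)` for some constant `C > 0`. -/
def IsSubmultiplicative (ω : (Fin d → ℤ) → ℝ) : Prop :=
  ∃ C : ℝ, 0 < C ∧ ∀ m n, ω (m + n) ≤ C * ω m * ω n

/-- The Gelfand-Raikov-Shilov condition `lim_{m → ∞} ω(m n)^{1/m} = 1` for every `n`. -/
def IsGRS (ω : (Fin d → ℤ) → ℝ) : Prop :=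
  ∀ n, Filter.Tendsto (fun m : ℕ => ω (m • n) ^ (1 / (m : ℝ))) Filter.atTop (𝓝 1)

/-- `sup_n ω(k n) / ω(n) < ∞` for every natural number `k`. -/
def IsBalanced (ω : (Fin d → ℤ) → ℝ) : Prop :=
  ∀ k : ℕ, BddAbove (Set.range fun n : Fin d → ℤ => ω (k • n) / ω n)

/-- An admissible weight is an even submultiplicative weight. -/
def IsAdmissible (ω : (Fin d → ℤ) → ℝ) : Prop :=
  IsWeight ω ∧ (∀ n, ω (-n) = ω n) ∧ IsSubmultiplicative ω

/-- The weight tolerates dilation by the real factor `t`: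
`sup_n ω(⌈t n⌉) / ω(n) < ∞`, where `⌈·⌉` is taken in each coordinate. -/
def IsDilationBounded (t : ℝ) (ω : (Fin d → ℤ) → ℝ) : Prop :=
  BddAbove (Set.range fun n : Fin d → ℤ => ω (fun k => ⌈t * (n k : ℝ)⌉) / ω n)

/-- The maximum norm `|n| = max_k |n_k|` on `ℤ^d`. -/
def maxAbs (n : Fin d → ℤ) : ℕ :=
  Finset.univ.sup fun k => (n k).natAbs

/-! ### Operator matrices and their slants -/

/-- Operator matrices `(a_{mn})`, `m, n ∈ ℤ^d`, of bounded operators `a_{mn} : X_n → Y_m`. -/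
abbrev OpMatrix (X Y : (Fin d → ℤ) → Type*)
    [∀ n, NormedAddCommGroup (X n)] [∀ n, NormedSpace ℂ (X n)]
    [∀ n, NormedAddCommGroup (Y n)] [∀ n, NormedSpace ℂ (Y n)] :=
  ∀ m n : Fin d → ℤ, X n →L[ℂ] Y m

section Matrices

variable {X Y : (Fin d → ℤ) → Type*}
  [∀ n, NormedAddCommGroup (X n)] [∀ n, NormedSpace ℂ (X n)]
  [∀ n, NormedAddCommGroup (Y n)] [∀ n, NormedSpace ℂ (Y n)]

open Classical in
/-- The `j`-th `α`-slant of a matrix: keep the entries with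
`α m_k - n_k ∈ [j_k, j_k + 1)` for all `k`, and replace the others by `0`. -/
def slant (α : ℝ) (A : OpMatrix X Y) (j : Fin d → ℤ) : OpMatrix X Y := fun m n =>
  if ∀ k, α * (m k : ℝ) - (n k : ℝ) ∈ Set.Ico (j k : ℝ) ((j k : ℝ) + 1) then A m n else 0

/-- `‖A‖_sup = sup_{m,n} ‖a_{mn}‖`, as an element of `[0, ∞]`. -/
def supNorm (A : OpMatrix X Y) : ℝ≥0∞ :=
  ⨆ (m : Fin d → ℤ) (n : Fin d → ℤ), ‖A m n‖ₑ

/-- `‖A‖_{Σ^ω_α} = K ∑_j ‖A_j‖_sup ω(j)` with `K = ⌈|α⁻¹|⌉^d`, as an element of `[0, ∞]`. -/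
def sigmaNorm (α : ℝ) (ω : (Fin d → ℤ) → ℝ) (A : OpMatrix X Y) : ℝ≥0∞ :=
  ((⌈|α⁻¹|⌉₊ ^ d : ℕ) : ℝ≥0∞) *
    ∑' j : Fin d → ℤ, supNorm (slant α A j) * ENNReal.ofReal (ω j)

/-- The class `Σ^ω_α` of matrices with `ω`-summable `α`-slants. -/
def MemSigma (α : ℝ) (ω : (Fin d → ℤ) → ℝ) (A : OpMatrix X Y) : Prop :=
  sigmaNorm α ω A < ∞

/-- The class `𝓔_α` of matrices in `Σ_α` (weight `1`) with exponential decay of `α`-slants. -/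
def MemExp (α : ℝ) (A : OpMatrix X Y) : Prop :=
  MemSigma α (fun _ => 1) A ∧
    ∃ C τ : ℝ, 0 < τ ∧ τ < 1 ∧ ∀ j : Fin d → ℤ,
      sigmaNorm α (fun _ => 1) (slant α A j) ≤ ENNReal.ofReal (C * τ ^ maxAbs j)

/-- `T` is the bounded operator `ℓ^p(ℤ^d,(X_n)) → ℓ^p(ℤ^d,(Y_n))` given by the matrix `A`:
`(T x)_m = ∑_n a_{mn} x_n`, where all these series converge. -/
def Represents (A : OpMatrix X Y) (p : ℝ≥0∞) [Fact (1 ≤ p)]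
    (T : lp X p →L[ℂ] lp Y p) : Prop :=
  ∀ (x : lp X p) (m : Fin d → ℤ), HasSum (fun n => A m n (x n)) (T x m)

/-- The matrix `A` gives an invertible operator on `ℓ^p`: a bounded bijection
`ℓ^p(ℤ^d,(X_n)) → ℓ^p(ℤ^d,(Y_n))` with bounded inverse. -/
def InvertibleOn (A : OpMatrix X Y) (p : ℝ≥0∞) [Fact (1 ≤ p)] : Prop :=
  ∃ T : lp X p ≃L[ℂ] lp Y p, Represents A p (T : lp X p →L[ℂ] lp Y p)

/-- The matrix `A` gives an invertible operator on `ℓ^p`, and the inverse operator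
is the one given by the matrix `B`. -/
def InvertibleOnWithInverse (A : OpMatrix X Y) (B : OpMatrix Y X) (p : ℝ≥0∞)
    [Fact (1 ≤ p)] : Prop :=
  ∃ T : lp X p ≃L[ℂ] lp Y p,
    Represents A p (T : lp X p →L[ℂ] lp Y p) ∧
      Represents B p (T.symm : lp Y p →L[ℂ] lp X p)

end Matrices

end Slanted

end

/-! Since `n` is integral, `α m - n ∈ [j, j + 1)` means `⌊α m⌋ - n = j`. With `φ(m) = ⌊α m⌋`, a map
with uniformly bounded fibres, slants become diagonals: on `ℓ^p` the operator is `T = ∑ₖ Dₖ`, where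
`Dₖ` is supported on `φ(m) - n = k` and `‖Dₖ‖` is at most a constant times the sup norm of the
`k`-th slant.

Modulation by a unitary character, `χ(n)` on the source and `χ(φ(m))` on the target, conjugates `Dₖ`
into `χ(k) Dₖ`. Hence the series `∑ₖ χ(k) T⁻¹Dₖ`, with coefficients in the bounded operators on
`ℓ^p(X)`, is invertible at every `χ`. Wiener's lemma in the form of Bochner and Phillips
(`exists_leftInverse_of_forall_char`) makes its inverse an `ω`-summable series. Comparing Fourier
coefficients gives `‖b_{nm}‖ ≤ γ(n - φ(m))` for the matrix of `T⁻¹`, with `γ` `ω`-summable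
(`exists_profile_symm`).

Wiener's lemma rests on maximal left ideals of `ℓ¹_w(G, 𝔅)`: translations are central, so they act
as scalars modulo such an ideal and define a character, unitary by the GRS condition. Modulo the
ideal the series equals its value at that character, and a left inverse of the value would put `1`
in the ideal.

As `⌊α⁻¹ n⌋ - m` stays within bounded distance of `⌈α⁻¹ (n - φ(m))⌉`, the dilation condition on `ω`
turns this decay into membership in `Σ` for the slope `α⁻¹` (`memSigma_inv_of_norm_le`). The
identities `AB = 1` and `BA = 1` then hold entrywise and, by absolute convergence, on every `ℓ^q`.

Exponential decay is obtained separately, by conjugating with `exp(ψ)` for a slowly varying bounded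
`ψ`: the operator changes little, so the conjugated inverse stays bounded (`exists_exp_decay_symm`).
-/

noncomputable section

namespace Slanted

/-! ### Maximal left ideals of a complex Banach algebra -/

section MaximalIdeal

variable {R : Type*} [NormedRing R] [NormedAlgebra ℂ R] [CompleteSpace R]

/-- Central elements of a complex Banach algebra act as scalars modulo a maximal left ideal. -/
theorem exists_sub_smul_one_mem_of_isMaximal {M : Ideal R} (hM : M.IsMaximal) {z : R}
    (hz : ∀ r, z * r = r * z) : ∃ c : ℂ, z - c • 1 ∈ M := by
  have hcl : IsClosed (M : Set R) := inferInstance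
  let N : Submodule ℂ R := M.restrictScalars ℂ
  have hN : IsClosed (N : Set R) := hcl
  have : Nontrivial (R ⧸ N) := by
    refine ⟨N.mkQ 1, 0, fun h => hM.ne_top ((Ideal.eq_top_iff_one M).2 ?_)⟩
    simpa [N] using h
  have hle : N ≤ N.comap (LinearMap.mulLeft ℂ z) := fun r hr => M.mul_mem_left z hr
  let L₀ : (R ⧸ N) →ₗ[ℂ] (R ⧸ N) := N.mapQ N (LinearMap.mulLeft ℂ z) hle
  have hL₀ : Continuous L₀ := by
    refine (N.isOpenQuotientMap_mkQ).isQuotientMap.continuous_iff.2 ?_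
    have : (L₀ ∘ N.mkQ) = fun r => N.mkQ (z * r) := by
      ext r; simp [L₀]
    rw [this]
    exact (N.isOpenQuotientMap_mkQ).continuous.comp (continuous_const.mul continuous_id)
  let L : (R ⧸ N) →L[ℂ] (R ⧸ N) := ⟨L₀, hL₀⟩
  -- Gelfand–Mazur on the nonzero Banach space `R ⧸ M`: the spectrum of multiplication by `z` is
  -- nonempty. If `z - c` were outside `M`, maximality and centrality would make `L - c` bijective,
  -- contradicting `c` being spectral.
  obtain ⟨c, hc⟩ := spectrum.nonempty (A := (R ⧸ N) →L[ℂ] (R ⧸ N)) L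
  refine ⟨c, ?_⟩
  by_contra hcM
  refine hc ?_
  rw [spectrum.mem_resolventSet_iff, ← IsUnit.neg_iff, neg_sub,
    ContinuousLinearMap.isUnit_iff_bijective]
  have happ : ∀ r, (L - algebraMap ℂ _ c) (N.mkQ r) = N.mkQ (r * (z - c • 1)) := by
    intro r
    simp [L, L₀, mul_sub, hz r, Algebra.algebraMap_eq_smul_one]
  have hcomm : ∀ r, (z - c • 1) * r = r * (z - c • 1) := by
    intro r; simp [mul_sub, sub_mul, hz r]
  constructor
  · rw [injective_iff_map_eq_zero]
    intro q hq
    obtain ⟨r, rfl⟩ := N.mkQ_surjective q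
    rw [happ] at hq
    have hr : r * (z - c • 1) ∈ M := by simpa [N] using hq
    by_contra hr0
    have hrM : r ∉ M := fun h => hr0 (by simpa [N] using h)
    obtain ⟨s, m, hm, hs⟩ := hM.exists_inv hrM
    apply hcM
    have : z - c • 1 = s * (r * (z - c • 1)) + (z - c • 1) * m := by
      rw [hcomm m, ← mul_assoc, ← add_mul, hs, one_mul]
    rw [this]
    exact M.add_mem (M.mul_mem_left _ hr) (M.mul_mem_left _ hm)
  · intro q
    obtain ⟨r, rfl⟩ := N.mkQ_surjective q
    obtain ⟨s, m, hm, hs⟩ := hM.exists_inv hcM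
    refine ⟨N.mkQ (r * s), ?_⟩
    rw [happ, ← sub_eq_zero, ← map_sub]
    have : r * s * (z - c • 1) - r = - (r * m) := by
      rw [mul_assoc, eq_sub_of_add_eq hs]; noncomm_ring
    rw [this]
    simpa [N] using M.mul_mem_left r hm

omit [CompleteSpace R] in
-- Two different scalars would put an invertible multiple of `1` into `M`. This uniqueness is what
-- makes the scalars attached to translations multiplicative.
theorem sub_smul_one_mem_unique {M : Ideal R} (hM : M ≠ ⊤) {z : R} {b c : ℂ}
    (hb : z - b • 1 ∈ M) (hc : z - c • 1 ∈ M) : b = c := by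
  by_contra h
  apply hM
  rw [Ideal.eq_top_iff_one]
  have h1 : (c - b) • (1 : R) ∈ M := by
    have := M.sub_mem hb hc
    rwa [sub_sub_sub_cancel_left, ← sub_smul] at this
  have h2 := M.mul_mem_left ((c - b)⁻¹ • (1 : R)) h1
  rwa [smul_mul_smul_comm, inv_mul_cancel₀ (sub_ne_zero.2 (Ne.symm h)), one_smul, one_mul] at h2

end MaximalIdeal

/-! ### The space `ℓ¹(G, F)` -/

/-- The Banach space `ℓ¹(G, F)`. -/
def EllOne (G F : Type*) [NormedAddCommGroup F] : Type _ := lp (fun _ : G => F) 1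

namespace EllOne

variable {G F W : Type*} [NormedAddCommGroup F]

instance : NormedAddCommGroup (EllOne G F) :=
  inferInstanceAs (NormedAddCommGroup (lp (fun _ : G => F) 1))

instance [NormedSpace ℂ F] : NormedSpace ℂ (EllOne G F) :=
  inferInstanceAs (NormedSpace ℂ (lp (fun _ : G => F) 1))

instance [CompleteSpace F] : CompleteSpace (EllOne G F) :=
  inferInstanceAs (CompleteSpace (lp (fun _ : G => F) 1))

/-- The `k`-th term of a summable family. -/
def coeff (h : EllOne G F) (k : G) : F := (show lp (fun _ : G => F) 1 from h) k

theorem hasSum_norm (h : EllOne G F) : HasSum (fun k => ‖h.coeff k‖) ‖h‖ := by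
  have := lp.hasSum_norm (p := 1) (by simp) (show lp (fun _ : G => F) 1 from h)
  simp only [ENNReal.toReal_one, Real.rpow_one] at this
  exact this

variable [NormedSpace ℂ F] [NormedAddCommGroup W] [NormedSpace ℂ W] [CompleteSpace W]

theorem summable_apply (T : G → F →L[ℂ] W) {C : ℝ} (hT : ∀ k, ‖T k‖ ≤ C)
    (h : EllOne G F) : Summable fun k => T k (h.coeff k) :=
  Summable.of_norm_bounded (h.hasSum_norm.summable.mul_left C) fun k =>
    (T k).le_of_opNorm_le (hT k) _

/-- The operator `h ↦ ∑ₖ Tₖ hₖ` on `ℓ¹` for a bounded family `(Tₖ)`. -/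
def lift (T : G → F →L[ℂ] W) (C : ℝ) (hT : ∀ k, ‖T k‖ ≤ C) : EllOne G F →L[ℂ] W :=
  LinearMap.mkContinuous
    { toFun := fun h => ∑' k, T k (h.coeff k)
      map_add' := fun g h => by
        rw [← (summable_apply T hT g).tsum_add (summable_apply T hT h)]
        exact tsum_congr fun k => map_add (T k) _ _
      map_smul' := fun c h => by
        rw [RingHom.id_apply, ← (summable_apply T hT h).tsum_const_smul c]
        exact tsum_congr fun k => map_smul (T k) _ _ } C fun h =>
    tsum_of_norm_bounded (h.hasSum_norm.mul_left C) fun k => (T k).le_of_opNorm_le (hT k) _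

theorem lift_apply (T : G → F →L[ℂ] W) (C : ℝ) (hT : ∀ k, ‖T k‖ ≤ C) (h : EllOne G F) :
    lift T C hT h = ∑' k, T k (h.coeff k) := rfl

theorem norm_lift_le (T : G → F →L[ℂ] W) {C : ℝ} (hC : 0 ≤ C) (hT : ∀ k, ‖T k‖ ≤ C) :
    ‖lift T C hT‖ ≤ C :=
  LinearMap.mkContinuous_norm_le _ hC _

variable [DecidableEq G]

/-- The family with the single term `b` at `k`. -/
def single (k : G) : F →L[ℂ] EllOne G F :=
  lp.singleContinuousLinearMap ℂ (fun _ : G => F) 1 k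

theorem coeff_single (k l : G) (b : F) : (single k b).coeff l = Pi.single (M := fun _ => F) k b l :=
  rfl

theorem norm_single_le (k : G) : ‖single (F := F) k‖ ≤ 1 :=
  ContinuousLinearMap.opNorm_le_bound _ zero_le_one fun x =>
    (lp.norm_single (p := 1) (E := fun _ : G => F) one_pos k x).le.trans_eq (one_mul _).symm

@[simp]
theorem lift_single (T : G → F →L[ℂ] W) (C : ℝ) (hT : ∀ k, ‖T k‖ ≤ C)
    (k : G) (b : F) : lift T C hT (single k b) = T k b := by
  rw [lift_apply, tsum_eq_single k]
  · simp [coeff_single]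
  · intro l hl
    simp [coeff_single, hl]

omit [CompleteSpace W] in
theorem clm_ext {S T : EllOne G F →L[ℂ] W}
    (h : ∀ k b, S (single k b) = T (single k b)) : S = T := by
  refine lp.ext_continuousLinearMap (p := 1) (E := fun _ : G => F) ENNReal.one_ne_top fun k => ?_
  ext b
  exact h k b

end EllOne

/-! ### The weighted convolution algebra `ℓ¹_w(G, 𝔅)` -/

section Convolution

variable {G : Type*} [AddCommGroup G] [DecidableEq G]
  {𝔅 : Type*} [NormedRing 𝔅] [NormedAlgebra ℂ 𝔅] [CompleteSpace 𝔅]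

/-- A submultiplicative weight on a commutative group. -/
structure IsBeurling (w : G → ℝ) : Prop where
  one_le : ∀ k, 1 ≤ w k
  mul : ∀ i j, w (i + j) ≤ w i * w j

omit [DecidableEq G] in
theorem IsBeurling.pos {w : G → ℝ} (hw : IsBeurling w) (k : G) : 0 < w k :=
  one_pos.trans_le (hw.one_le k)

variable {w : G → ℝ} (hw : IsBeurling w)

variable (𝔅) in
/-- Translation by `i` on `ℓ¹_w`, transported to the unweighted `ℓ¹` by `h ↦ w h`. -/
def wShift (i : G) : EllOne G 𝔅 →L[ℂ] EllOne G 𝔅 :=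
  EllOne.lift (fun k => ((w (k + i) / w k : ℝ) : ℂ) • EllOne.single (k + i)) (w i) fun k => by
    have h2 : w (k + i) / w k ≤ w i := by
      rw [div_le_iff₀ (hw.pos k), mul_comm]; exact hw.mul k i
    have h0 : 0 ≤ w (k + i) / w k := (div_pos (hw.pos _) (hw.pos _)).le
    rw [norm_smul, Complex.norm_real, Real.norm_of_nonneg h0]
    calc _ ≤ w (k + i) / w k * 1 := by gcongr; exact EllOne.norm_single_le _
      _ ≤ w i := by rwa [mul_one]

@[simp]
theorem wShift_single (i k : G) (b : 𝔅) : wShift 𝔅 hw i (EllOne.single k b) =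
    ((w (k + i) / w k : ℝ) : ℂ) • EllOne.single (k + i) b := by
  rw [wShift, EllOne.lift_single]; rfl

theorem norm_wShift_le (i : G) : ‖wShift 𝔅 hw i‖ ≤ w i :=
  EllOne.norm_lift_le _ (hw.pos i).le _

theorem wShift_mul (i j : G) : wShift 𝔅 hw i * wShift 𝔅 hw j = wShift 𝔅 hw (i + j) := by
  refine EllOne.clm_ext fun k b => ?_
  simp only [mul_apply_eq_comp, wShift_single, map_smul, smul_smul]
  rw [add_assoc, add_comm j i]
  congr 1
  rw [← Complex.ofReal_mul, mul_comm, div_mul_div_cancel₀ (hw.pos _).ne']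

theorem wShift_zero : wShift 𝔅 hw 0 = 1 := by
  refine EllOne.clm_ext fun k b => ?_
  rw [wShift_single, add_zero, div_self (hw.pos k).ne']
  simp

variable (G) in
/-- Pointwise right multiplication by `b` on `ℓ¹`. -/
def l1RMul (b : 𝔅) : EllOne G 𝔅 →L[ℂ] EllOne G 𝔅 :=
  EllOne.lift (fun k => (EllOne.single k).comp ((ContinuousLinearMap.mul ℂ 𝔅).flip b)) ‖b‖
    fun k => (ContinuousLinearMap.opNorm_comp_le _ _).trans <|
      (mul_le_mul (EllOne.norm_single_le k) (ContinuousLinearMap.opNorm_le_bound _ (norm_nonneg b)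
        fun x => by simpa [mul_comm] using norm_mul_le x b) (norm_nonneg _) zero_le_one).trans_eq
        (one_mul _)

variable (G) in
/-- Pointwise left multiplication by `b` on `ℓ¹`. -/
def l1LMul (b : 𝔅) : EllOne G 𝔅 →L[ℂ] EllOne G 𝔅 :=
  EllOne.lift (fun k => (EllOne.single k).comp (ContinuousLinearMap.mul ℂ 𝔅 b)) ‖b‖
    fun k => (ContinuousLinearMap.opNorm_comp_le _ _).trans <|
      (mul_le_mul (EllOne.norm_single_le k) (ContinuousLinearMap.opNorm_le_bound _ (norm_nonneg b)
        fun x => by simpa using norm_mul_le b x) (norm_nonneg _) zero_le_one).trans_eq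
        (one_mul _)

omit [AddCommGroup G] in
@[simp]
theorem l1RMul_single (b : 𝔅) (k : G) (c : 𝔅) :
    l1RMul G b (EllOne.single k c) = EllOne.single k (c * b) := by
  rw [l1RMul, EllOne.lift_single]; rfl

omit [AddCommGroup G] in
@[simp]
theorem l1LMul_single (b : 𝔅) (k : G) (c : 𝔅) :
    l1LMul G b (EllOne.single k c) = EllOne.single k (b * c) := by
  rw [l1LMul, EllOne.lift_single]; rfl

omit [AddCommGroup G] in
theorem norm_l1LMul_le (b : 𝔅) : ‖l1LMul G b‖ ≤ ‖b‖ :=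
  EllOne.norm_lift_le _ (norm_nonneg b) _

variable (𝔅) in
/-- The convolution algebra `ℓ¹_w(G, 𝔅)`, as the algebra of bounded operators on `ℓ¹_w` that
commute with the translations and the right multiplications. -/
def convAlg : Subalgebra ℂ (EllOne G 𝔅 →L[ℂ] EllOne G 𝔅) :=
  Subalgebra.centralizer ℂ (Set.range (wShift 𝔅 hw) ∪ Set.range (l1RMul G))

instance : CompleteSpace (convAlg 𝔅 hw) :=
  (Set.isClosed_centralizer (M := EllOne G 𝔅 →L[ℂ] EllOne G 𝔅) _).completeSpace_coe

theorem convAlg_commute_wShift (T : convAlg 𝔅 hw) (i : G) (v : EllOne G 𝔅) :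
    T.1 (wShift 𝔅 hw i v) = wShift 𝔅 hw i (T.1 v) :=
  (DFunLike.congr_fun (T.2 _ (Or.inl ⟨i, rfl⟩)) v).symm

theorem convAlg_commute_l1RMul (T : convAlg 𝔅 hw) (b : 𝔅) (v : EllOne G 𝔅) :
    T.1 (l1RMul G b v) = l1RMul G b (T.1 v) :=
  (DFunLike.congr_fun (T.2 _ (Or.inr ⟨b, rfl⟩)) v).symm

variable (𝔅) in
/-- Translation by `i`, as a central element of the convolution algebra. -/
def convShift (i : G) : convAlg 𝔅 hw :=
  ⟨wShift 𝔅 hw i, by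
    rintro _ (⟨j, rfl⟩ | ⟨b, rfl⟩)
    · rw [wShift_mul, wShift_mul, add_comm]
    · exact EllOne.clm_ext fun k c => by simp⟩

theorem convShift_central (i : G) (T : convAlg 𝔅 hw) :
    convShift 𝔅 hw i * T = T * convShift 𝔅 hw i :=
  Subtype.ext <| T.2 _ (Or.inl ⟨i, rfl⟩)

theorem convShift_mul (i j : G) :
    convShift 𝔅 hw i * convShift 𝔅 hw j = convShift 𝔅 hw (i + j) :=
  Subtype.ext (wShift_mul hw i j)

theorem convShift_zero : convShift 𝔅 hw 0 = 1 :=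
  Subtype.ext (wShift_zero hw)

theorem norm_convShift_le (i : G) : ‖convShift 𝔅 hw i‖ ≤ w i := norm_wShift_le hw i

theorem l1LMul_mem_convAlg (b : 𝔅) : l1LMul G b ∈ convAlg 𝔅 hw := by
  rintro _ (⟨j, rfl⟩ | ⟨c, rfl⟩)
  · exact EllOne.clm_ext fun k c => by simp
  · exact EllOne.clm_ext fun k c => by simp [mul_assoc]

/-- The embedding of the coefficient algebra `𝔅` into the convolution algebra. -/
def convCoeff : 𝔅 →L[ℂ] convAlg 𝔅 hw :=
  LinearMap.mkContinuous
    { toFun := fun b => (⟨l1LMul G b, l1LMul_mem_convAlg hw b⟩ : convAlg 𝔅 hw)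
      map_add' := fun b c => Subtype.ext <| EllOne.clm_ext fun k x => by simp [add_mul]
      map_smul' := fun b c => Subtype.ext <| EllOne.clm_ext fun k x => by simp } 1 fun b => by
    rw [one_mul]; exact norm_l1LMul_le b

theorem convCoeff_coe (b : 𝔅) : (convCoeff hw b).1 = l1LMul G b := rfl

theorem norm_convCoeff_le (b : 𝔅) : ‖convCoeff hw b‖ ≤ ‖b‖ := norm_l1LMul_le b

theorem convCoeff_mul (b c : 𝔅) : convCoeff hw b * convCoeff hw c = convCoeff hw (b * c) :=
  Subtype.ext <| EllOne.clm_ext fun k x => by simp [convCoeff_coe, mul_assoc]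

theorem convCoeff_one : convCoeff (𝔅 := 𝔅) hw 1 = 1 :=
  Subtype.ext <| EllOne.clm_ext fun k x => by simp [convCoeff_coe]

variable (𝔅) in
/-- The unit of `ℓ¹_w(G, 𝔅)`. -/
def l1Unit (w : G → ℝ) : EllOne G 𝔅 := EllOne.single 0 ((w 0 : ℂ) • 1)

/-- The value `∑ₖ χ(k) hₖ` of `h ∈ ℓ¹_w(G, 𝔅)` at a unitary character `χ`. -/
def charEval {χ : AddChar G ℂ} (hχ : ∀ k, ‖χ k‖ = 1) : EllOne G 𝔅 →L[ℂ] 𝔅 :=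
  EllOne.lift (fun k => (χ k / (w k : ℂ)) • ContinuousLinearMap.id ℂ 𝔅) 1 fun k => by
    have hk := hw.pos k
    rw [norm_smul, norm_div, hχ, Complex.norm_real, Real.norm_of_nonneg hk.le, one_div]
    exact mul_le_one₀ (inv_le_one_of_one_le₀ (hw.one_le k)) (norm_nonneg _)
      ContinuousLinearMap.norm_id_le

variable {χ : AddChar G ℂ} (hχ : ∀ k, ‖χ k‖ = 1)

theorem charEval_single (k : G) (b : 𝔅) :
    charEval hw hχ (EllOne.single k b) = (χ k / (w k : ℂ)) • b := by
  rw [charEval, EllOne.lift_single]; rfl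

theorem charEval_wShift (i : G) (v : EllOne G 𝔅) :
    charEval hw hχ (wShift 𝔅 hw i v) = χ i • charEval hw hχ v := by
  have : (charEval hw hχ).comp (wShift 𝔅 hw i) = χ i • charEval hw hχ := by
    refine EllOne.clm_ext fun k b => ?_
    have h1 : (w (k + i) : ℂ) ≠ 0 := by exact_mod_cast (hw.pos _).ne'
    have h2 : (w k : ℂ) ≠ 0 := by exact_mod_cast (hw.pos _).ne'
    simp only [ContinuousLinearMap.comp_apply, wShift_single, map_smul, charEval_single,
      smul_apply, smul_smul, AddChar.map_add_eq_mul]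
    congr 1
    push_cast
    field_simp
  exact DFunLike.congr_fun this v

theorem charEval_l1RMul (b : 𝔅) (v : EllOne G 𝔅) :
    charEval hw hχ (l1RMul G b v) = charEval hw hχ v * b := by
  have : (charEval hw hχ).comp (l1RMul G b) =
      ((ContinuousLinearMap.mul ℂ 𝔅).flip b).comp (charEval hw hχ) := by
    refine EllOne.clm_ext fun k c => ?_
    simp [charEval_single]
  exact DFunLike.congr_fun this v

theorem charEval_l1LMul (b : 𝔅) (v : EllOne G 𝔅) :
    charEval hw hχ (l1LMul G b v) = b * charEval hw hχ v := by
  have : (charEval hw hχ).comp (l1LMul G b) =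
      (ContinuousLinearMap.mul ℂ 𝔅 b).comp (charEval hw hχ) := by
    refine EllOne.clm_ext fun k c => ?_
    simp [charEval_single]
  exact DFunLike.congr_fun this v

theorem charEval_l1Unit : charEval hw hχ (l1Unit 𝔅 w) = 1 := by
  have h2 : (w 0 : ℂ) ≠ 0 := by exact_mod_cast (hw.pos _).ne'
  rw [l1Unit, charEval_single, smul_smul, AddChar.map_zero_eq_one, div_mul_cancel₀ _ h2, one_smul]

/-- Evaluation at a unitary character is multiplicative. -/
theorem charEval_apply (T : convAlg 𝔅 hw) (v : EllOne G 𝔅) :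
    charEval hw hχ (T.1 v) = charEval hw hχ (T.1 (l1Unit 𝔅 w)) * charEval hw hχ v := by
  have : (charEval hw hχ).comp T.1 = (ContinuousLinearMap.mul ℂ 𝔅
      (charEval hw hχ (T.1 (l1Unit 𝔅 w)))).comp (charEval hw hχ) := by
    refine EllOne.clm_ext fun k b => ?_
    have h0 : (w 0 : ℂ) ≠ 0 := by exact_mod_cast (hw.pos _).ne'
    have h2 : (w k : ℂ) ≠ 0 := by exact_mod_cast (hw.pos _).ne'
    -- Single terms arise from the unit by a translation and a right multiplication. Elements of the
    -- algebra commute with both, so they are determined by their value at the unit.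
    have hs : EllOne.single k b = (w k : ℂ)⁻¹ • wShift 𝔅 hw k (l1RMul G b (l1Unit 𝔅 w)) := by
      rw [l1Unit, l1RMul_single, wShift_single, smul_smul, smul_mul_assoc, one_mul, map_smul,
        smul_smul, zero_add]
      push_cast
      rw [show (w k : ℂ)⁻¹ * (w k / w 0) * w 0 = 1 by field_simp, one_smul]
    rw [ContinuousLinearMap.comp_apply, hs, map_smul, convAlg_commute_wShift,
      convAlg_commute_l1RMul, map_smul, charEval_wShift, charEval_l1RMul, ← hs,
      ContinuousLinearMap.comp_apply, charEval_single, ContinuousLinearMap.mul_apply', smul_smul,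
      mul_smul_comm, div_eq_inv_mul]
  exact DFunLike.congr_fun this v

end Convolution

/-! ### Wiener's lemma for operator-valued series with a GRS weight -/

section Wiener

variable {G : Type*} [AddCommGroup G] [DecidableEq G]
  {𝔅 : Type*} [NormedRing 𝔅] [NormedAlgebra ℂ 𝔅] [CompleteSpace 𝔅]
  {w : G → ℝ} (hw : IsBeurling w)

theorem tendsto_const_rpow_one_div {c : ℝ} (hc : 0 < c) :
    Filter.Tendsto (fun m : ℕ => c ^ (1 / (m : ℝ))) Filter.atTop (𝓝 1) := by
  have := (tendsto_const_nhds (x := c)).rpow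
    (tendsto_one_div_atTop_nhds_zero_nat (𝕜 := ℝ)) (Or.inl hc.ne')
  simpa using this

/-- A real number whose powers are dominated by a sequence of subexponential growth is at
most `1`. -/
theorem le_one_of_pow_le_of_tendsto {x c : ℝ} {u : ℕ → ℝ} (hx : 0 ≤ x) (hc : 0 < c)
    (hu : ∀ m, 0 ≤ u m) (h : ∀ m, x ^ m ≤ u m * c)
    (hlim : Filter.Tendsto (fun m : ℕ => u m ^ (1 / (m : ℝ))) Filter.atTop (𝓝 1)) : x ≤ 1 := by
  have h1 := tendsto_const_rpow_one_div hc
  have h2 := hlim.mul h1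
  rw [one_mul] at h2
  refine ge_of_tendsto h2 ?_
  filter_upwards [Filter.eventually_gt_atTop 0] with m hm
  have hm' : (m : ℝ) ≠ 0 := by exact_mod_cast hm.ne'
  rw [← Real.mul_rpow (hu m) hc.le]
  calc x = (x ^ m) ^ (1 / (m : ℝ)) := by
        rw [← Real.rpow_natCast, ← Real.rpow_mul hx, mul_one_div_cancel hm', Real.rpow_one]
    _ ≤ _ := Real.rpow_le_rpow (pow_nonneg hx m) (h m) (by positivity)

/-- The central translations act on the quotient by a maximal left ideal through a character of
the group, which is unitary if the weight satisfies the GRS condition. -/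
theorem exists_addChar_of_isMaximal {M : Ideal (convAlg 𝔅 hw)} (hM : M.IsMaximal)
    (hGRS : ∀ n, Filter.Tendsto (fun m : ℕ => w (m • n) ^ (1 / (m : ℝ))) Filter.atTop (𝓝 1)) :
    ∃ χ : AddChar G ℂ, (∀ k, ‖χ k‖ = 1) ∧
      ∀ k, convShift 𝔅 hw k - χ k • 1 ∈ M := by
  choose χ hχ using fun k =>
    exists_sub_smul_one_mem_of_isMaximal hM (z := convShift 𝔅 hw k) (convShift_central hw k)
  have h0 : χ 0 = 1 := by
    refine sub_smul_one_mem_unique hM.ne_top (hχ 0) ?_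
    rw [convShift_zero, one_smul, sub_self]
    exact M.zero_mem
  have hadd : ∀ i j, χ (i + j) = χ i * χ j := by
    intro i j
    refine sub_smul_one_mem_unique hM.ne_top (hχ (i + j)) ?_
    rw [← convShift_mul]
    have : convShift 𝔅 hw i * convShift 𝔅 hw j - (χ i * χ j) • 1 =
        convShift 𝔅 hw i * (convShift 𝔅 hw j - χ j • 1) +
          (χ j • 1 : convAlg 𝔅 hw) * (convShift 𝔅 hw i - χ i • 1) := by
      simp only [mul_sub, smul_mul_assoc, mul_smul_comm, one_mul, mul_one, smul_smul,
        mul_comm (χ i)]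
      abel
    rw [this]
    exact M.add_mem (M.mul_mem_left _ (hχ j)) (M.mul_mem_left _ (hχ i))
  let ψ : AddChar G ℂ := ⟨χ, h0, hadd⟩
  have hle : ∀ k, ‖ψ k‖ ≤ 1 := by
    intro n
    have : Nontrivial (convAlg 𝔅 hw) := by
      by_contra h
      rw [not_nontrivial_iff_subsingleton] at h
      exact hM.ne_top (Subsingleton.elim _ _)
    refine le_one_of_pow_le_of_tendsto (c := ‖(1 : convAlg 𝔅 hw)‖) (norm_nonneg _)
      (norm_pos_iff.2 one_ne_zero) (fun m => (hw.pos (m • n)).le) (fun m => ?_) (hGRS n)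
    -- Translation minus its scalar lies in a proper left ideal, so the scalar is spectral. Hence
    -- `‖ψ n‖ ^ m ≤ w (m • n) * ‖1‖`, and the GRS condition forces `‖ψ n‖ ≤ 1`; applied to `k` and
    -- `-k`, this gives unitarity.
    have hs : ψ (m • n) ∈ spectrum ℂ (convShift 𝔅 hw (m • n)) := by
      intro hu
      rw [spectrum.mem_resolventSet_iff, ← IsUnit.neg_iff, neg_sub,
        Algebra.algebraMap_eq_smul_one] at hu
      exact hM.ne_top (M.eq_top_of_isUnit_mem (hχ (m • n)) hu)
    have := spectrum.norm_le_norm_mul_of_mem hs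
    rw [AddChar.map_nsmul_eq_pow, norm_pow] at this
    exact this.trans (mul_le_mul_of_nonneg_right (norm_convShift_le hw _) (norm_nonneg _))
  refine ⟨ψ, fun k => le_antisymm (hle k) ?_, hχ⟩
  have h1 : ‖ψ k‖ * ‖ψ (-k)‖ = 1 := by
    rw [← norm_mul, ← AddChar.map_add_eq_mul, add_neg_cancel, AddChar.map_zero_eq_one, norm_one]
  calc 1 = ‖ψ k‖ * ‖ψ (-k)‖ := h1.symm
    _ ≤ ‖ψ k‖ * 1 := by gcongr; exact hle _
    _ = ‖ψ k‖ := mul_one _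

variable (f : G → 𝔅)

/-- The element `∑ₖ fₖ δₖ` of the convolution algebra. -/
def convSum : convAlg 𝔅 hw := ∑' k, convCoeff hw (f k) * convShift 𝔅 hw k

variable {f} (hf : Summable fun k => ‖f k‖ * w k)
include hw hf

omit [DecidableEq G] [NormedAlgebra ℂ 𝔅] [CompleteSpace 𝔅] in
theorem summable_norm_of_beurling : Summable fun k => ‖f k‖ :=
  hf.of_nonneg_of_le (fun _ => norm_nonneg _) fun k =>
    le_mul_of_one_le_right (norm_nonneg _) (hw.one_le k)

theorem convSum_hasSum :
    HasSum (fun k => convCoeff hw (f k) * convShift 𝔅 hw k) (convSum hw f) := by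
  refine Summable.hasSum (Summable.of_norm_bounded hf fun k => ?_)
  exact (norm_mul_le _ _).trans (mul_le_mul (norm_convCoeff_le hw _) (norm_convShift_le hw _)
    (norm_nonneg _) (norm_nonneg _))

omit [DecidableEq G] in
theorem summable_char_smul {χ : AddChar G ℂ} (hχ : ∀ k, ‖χ k‖ = 1) :
    Summable fun k => χ k • f k :=
  Summable.of_norm_bounded (summable_norm_of_beurling hw hf) fun k => by
    rw [norm_smul, hχ, one_mul]

theorem charEval_convSum {χ : AddChar G ℂ} (hχ : ∀ k, ‖χ k‖ = 1) :
    charEval hw hχ ((convSum hw f).1 (l1Unit 𝔅 w)) = ∑' k, χ k • f k := by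
  let Φ : convAlg 𝔅 hw →L[ℂ] 𝔅 := (charEval hw hχ).comp
    ((ContinuousLinearMap.apply ℂ _ (l1Unit 𝔅 w)).comp (convAlg 𝔅 hw).toSubmodule.subtypeL)
  have h := (convSum_hasSum hw hf).mapL Φ
  rw [show charEval hw hχ ((convSum hw f).1 (l1Unit 𝔅 w)) = Φ (convSum hw f) from rfl, ← h.tsum_eq]
  refine tsum_congr fun k => ?_
  change charEval hw hχ (l1LMul G (f k) (wShift 𝔅 hw k (l1Unit 𝔅 w))) = _
  rw [charEval_l1LMul, charEval_wShift, charEval_l1Unit, mul_smul_comm, mul_one]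

/-- **Wiener's lemma** (Bochner–Phillips) for operator-valued absolutely convergent Fourier series
with a GRS weight: if the sum of the series is left invertible at all unitary characters, then
there is an absolutely convergent series that gives left inverses. -/
theorem exists_leftInverse_of_forall_char
    (hGRS : ∀ n, Filter.Tendsto (fun m : ℕ => w (m • n) ^ (1 / (m : ℝ))) Filter.atTop (𝓝 1))
    (hinv : ∀ χ : AddChar G ℂ, (∀ k, ‖χ k‖ = 1) → ∃ b, b * ∑' k, χ k • f k = 1) :
    ∃ g : G → 𝔅, (Summable fun k => ‖g k‖ * w k) ∧
      ∀ χ : AddChar G ℂ, (∀ k, ‖χ k‖ = 1) →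
        (∑' k, χ k • g k) * (∑' k, χ k • f k) = 1 := by
  have hspan : Ideal.span {convSum hw f} = ⊤ := by
    by_contra hne
    obtain ⟨M, hM, hle⟩ := Ideal.exists_le_maximal _ hne
    obtain ⟨χ, hχ, hχM⟩ := exists_addChar_of_isMaximal hw hM hGRS
    obtain ⟨b, hb⟩ := hinv χ hχ
    have hfM : convSum hw f ∈ M := hle (Ideal.subset_span rfl)
    have h1 : HasSum (fun k => χ k • convCoeff hw (f k)) (convCoeff hw (∑' k, χ k • f k)) := by
      simpa using (summable_char_smul hw hf hχ).hasSum.mapL (convCoeff hw)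
    have h2 := (convSum_hasSum hw hf).sub h1
    have hcl : IsClosed (M : Set (convAlg 𝔅 hw)) := inferInstance
    -- Modulo the closed ideal `M` each translation may be replaced by its scalar, so the series is
    -- congruent to the constant `∑ₖ χ(k) fₖ`.
    have h3 : convSum hw f - convCoeff hw (∑' k, χ k • f k) ∈ M := by
      refine hcl.mem_of_tendsto h2 (Filter.Eventually.of_forall fun s => M.sum_mem fun k _ => ?_)
      have : convCoeff hw (f k) * convShift 𝔅 hw k - χ k • convCoeff hw (f k) =
          convCoeff hw (f k) * (convShift 𝔅 hw k - χ k • 1) := by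
        rw [mul_sub, mul_smul_comm, mul_one]
      rw [this]
      exact M.mul_mem_left _ (hχM k)
    have h4 : convCoeff hw (∑' k, χ k • f k) ∈ M := by
      simpa using M.sub_mem hfM h3
    have h5 := M.mul_mem_left (convCoeff hw b) h4
    rw [convCoeff_mul, hb, convCoeff_one] at h5
    exact hM.ne_top ((Ideal.eq_top_iff_one M).2 h5)
  obtain ⟨g, hg⟩ := Ideal.mem_span_singleton'.1 ((Ideal.eq_top_iff_one _).1 hspan)
  let v : EllOne G 𝔅 := g.1 (l1Unit 𝔅 w)
  -- Elements of `ℓ¹_w` are stored multiplied by `w`; the division recovers the actual coefficients.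
  refine ⟨fun k => (w k : ℂ)⁻¹ • v.coeff k, ?_, fun χ hχ => ?_⟩
  · refine v.hasSum_norm.summable.congr fun k => ?_
    rw [norm_smul, norm_inv, Complex.norm_real, Real.norm_of_nonneg (hw.pos k).le,
      mul_right_comm, inv_mul_cancel₀ (hw.pos k).ne', one_mul]
  · have h1 : ∑' k, χ k • (w k : ℂ)⁻¹ • v.coeff k = charEval hw hχ v := by
      rw [charEval, EllOne.lift_apply]
      refine tsum_congr fun k => ?_
      rw [smul_smul, div_eq_mul_inv]; rfl
    rw [h1, ← charEval_convSum hw hf hχ, ← charEval_apply hw hχ g]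
    have : g.1 ((convSum hw f).1 (l1Unit 𝔅 w)) = l1Unit 𝔅 w :=
      DFunLike.congr_fun (congrArg Subtype.val hg) (l1Unit 𝔅 w)
    rw [this, charEval_l1Unit]

end Wiener

/-! ### Operators on `ℓ^p` with one entry in each row -/

section RowOperator

variable {ι κ : Type*} [DecidableEq κ]

theorem sum_comp_le_of_card_fiber_le {φ : ι → κ} {K : ℕ}
    (hφ : ∀ (t : Finset ι) (k : κ), (t.filter (φ · = k)).card ≤ K) {F : κ → ℝ} (hF : ∀ k, 0 ≤ F k)
    {B : ℝ} (hB : ∀ t : Finset κ, ∑ k ∈ t, F k ≤ B) (t : Finset ι) :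
    ∑ m ∈ t, F (φ m) ≤ K * B := by
  rw [Finset.sum_comp F φ]
  calc ∑ b ∈ t.image φ, (t.filter (φ · = b)).card • F b ≤ ∑ b ∈ t.image φ, (K : ℝ) * F b := by
        refine Finset.sum_le_sum fun b _ => ?_
        rw [nsmul_eq_mul]
        exact mul_le_mul_of_nonneg_right (by exact_mod_cast hφ t b) (hF b)
    _ ≤ K * B := by
        rw [← Finset.mul_sum]
        exact mul_le_mul_of_nonneg_left (hB _) (Nat.cast_nonneg K)

variable {X : κ → Type*} {Y : ι → Type*}
  [∀ n, NormedAddCommGroup (X n)] [∀ n, NormedSpace ℂ (X n)]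
  [∀ n, NormedAddCommGroup (Y n)] [∀ n, NormedSpace ℂ (Y n)]
  {φ : ι → κ} {K : ℕ} {s : ℝ} {a : ∀ m, X (φ m) →L[ℂ] Y m}

omit [DecidableEq κ] in
theorem toReal_pos_of_fact (p : ℝ≥0∞) [hp : Fact (1 ≤ p)] (hp' : p ≠ ∞) : 0 < p.toReal :=
  ENNReal.toReal_pos (one_pos.trans_le hp.out).ne' hp'

theorem sum_rpow_row_le (hK : 1 ≤ K)
    (hφ : ∀ (t : Finset ι) (k : κ), (t.filter (φ · = k)).card ≤ K) (hs : 0 ≤ s)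
    (ha : ∀ m, ‖a m‖ ≤ s) {p : ℝ≥0∞} [hp : Fact (1 ≤ p)] (hp' : p ≠ ∞) (x : lp X p)
    (t : Finset ι) : ∑ m ∈ t, ‖a m (x (φ m))‖ ^ p.toReal ≤ (K * s * ‖x‖) ^ p.toReal := by
  have hpos := toReal_pos_of_fact p hp'
  have h1 : 1 ≤ p.toReal := by
    rw [← ENNReal.toReal_one]; exact ENNReal.toReal_mono hp' hp.out
  have hK' : (1 : ℝ) ≤ K := by exact_mod_cast hK
  calc ∑ m ∈ t, ‖a m (x (φ m))‖ ^ p.toReal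
      ≤ ∑ m ∈ t, s ^ p.toReal * ‖x (φ m)‖ ^ p.toReal := by
        refine Finset.sum_le_sum fun m _ => ?_
        rw [← Real.mul_rpow hs (norm_nonneg _)]
        exact Real.rpow_le_rpow (norm_nonneg _) ((a m).le_of_opNorm_le (ha m) _) hpos.le
    _ = s ^ p.toReal * ∑ m ∈ t, ‖x (φ m)‖ ^ p.toReal := by rw [Finset.mul_sum]
    _ ≤ s ^ p.toReal * (K * ‖x‖ ^ p.toReal) := by
        refine mul_le_mul_of_nonneg_left ?_ (Real.rpow_nonneg hs _)
        exact sum_comp_le_of_card_fiber_le hφ (F := fun k => ‖x k‖ ^ p.toReal)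
          (fun k => Real.rpow_nonneg (norm_nonneg _) _) (lp.sum_rpow_le_norm_rpow hpos x) t
    _ ≤ s ^ p.toReal * ((K : ℝ) ^ p.toReal * ‖x‖ ^ p.toReal) := by
        -- The natural constant `K ^ (1 / p)` is relaxed to `K`, which serves all exponents at once,
        -- including `∞`.
        have := Real.self_le_rpow_of_one_le hK' h1
        gcongr
    _ = (K * s * ‖x‖) ^ p.toReal := by
        rw [Real.mul_rpow (by positivity) (norm_nonneg _), Real.mul_rpow (by positivity) hs]
        ring

omit [DecidableEq κ] in
theorem norm_row_le (hK : 1 ≤ K) (hs : 0 ≤ s)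
    (ha : ∀ m, ‖a m‖ ≤ s) {p : ℝ≥0∞} [hp : Fact (1 ≤ p)] (x : lp X p) (m : ι) :
    ‖a m (x (φ m))‖ ≤ K * s * ‖x‖ := by
  have hK' : (1 : ℝ) ≤ K := by exact_mod_cast hK
  calc ‖a m (x (φ m))‖ ≤ s * ‖x (φ m)‖ := (a m).le_of_opNorm_le (ha m) _
    _ ≤ s * ‖x‖ := by
        gcongr; exact lp.norm_apply_le_norm (one_pos.trans_le hp.out).ne' x _
    _ ≤ K * (s * ‖x‖) := le_mul_of_one_le_left (by positivity) hK'
    _ = K * s * ‖x‖ := by ring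

theorem row_memℓp (hK : 1 ≤ K)
    (hφ : ∀ (t : Finset ι) (k : κ), (t.filter (φ · = k)).card ≤ K) (hs : 0 ≤ s)
    (ha : ∀ m, ‖a m‖ ≤ s) (p : ℝ≥0∞) [hp : Fact (1 ≤ p)] (x : lp X p) :
    Memℓp (fun m => a m (x (φ m))) p := by
  by_cases hp' : p = ∞
  · subst hp'
    refine memℓp_infty ⟨K * s * ‖x‖, ?_⟩
    rintro _ ⟨m, rfl⟩
    exact norm_row_le hK hs ha x m
  · exact memℓp_gen' (sum_rpow_row_le hK hφ hs ha hp' x)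

/-- The operator `(x_n) ↦ (a_m x_{φ(m)})` from `ℓ^p(X)` to `ℓ^p(Y)`, for a bounded family `(a_m)`
and a map `φ` with fibres of at most `K` elements. -/
def rowOp (hK : 1 ≤ K)
    (hφ : ∀ (t : Finset ι) (k : κ), (t.filter (φ · = k)).card ≤ K) (hs : 0 ≤ s)
    (ha : ∀ m, ‖a m‖ ≤ s) (p : ℝ≥0∞) [hp : Fact (1 ≤ p)] : lp X p →L[ℂ] lp Y p :=
  LinearMap.mkContinuous
    { toFun := fun x => ⟨fun m => a m (x (φ m)), row_memℓp hK hφ hs ha p x⟩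
      map_add' := fun x y => lp.ext <| funext fun m => map_add (a m) _ _
      map_smul' := fun c x => lp.ext <| funext fun m => map_smul (a m) _ _ } (K * s) fun x => by
    have h0 : 0 ≤ K * s * ‖x‖ := by positivity
    by_cases hp' : p = ∞
    · subst hp'
      exact lp.norm_le_of_forall_le h0 (norm_row_le hK hs ha x)
    · exact lp.norm_le_of_forall_sum_le (toReal_pos_of_fact p hp') h0
        (sum_rpow_row_le hK hφ hs ha hp' x)

theorem norm_rowOp_le (hK : 1 ≤ K)
    (hφ : ∀ (t : Finset ι) (k : κ), (t.filter (φ · = k)).card ≤ K) (hs : 0 ≤ s)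
    (ha : ∀ m, ‖a m‖ ≤ s) (p : ℝ≥0∞) [hp : Fact (1 ≤ p)] : ‖rowOp hK hφ hs ha p‖ ≤ K * s :=
  LinearMap.mkContinuous_norm_le _ (by positivity) _

end RowOperator

/-! ### Multiplication by bounded scalar sequences -/

section DiagOperator

variable {κ : Type*} {X : κ → Type*}
  [∀ n, NormedAddCommGroup (X n)] [∀ n, NormedSpace ℂ (X n)]

theorem norm_smul_id_le {c : κ → ℂ} {s : ℝ} (hc : ∀ n, ‖c n‖ ≤ s) (n : κ) :
    ‖c n • ContinuousLinearMap.id ℂ (X n)‖ ≤ s := by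
  rw [norm_smul]
  calc ‖c n‖ * _ ≤ ‖c n‖ * 1 := by gcongr; exact ContinuousLinearMap.norm_id_le
    _ ≤ s := by rw [mul_one]; exact hc n

open Classical in
/-- Multiplication by a bounded scalar sequence on `ℓ^p(X)`. -/
def diagOp {c : κ → ℂ} {s : ℝ} (hs : 0 ≤ s) (hc : ∀ n, ‖c n‖ ≤ s) (p : ℝ≥0∞) [Fact (1 ≤ p)] :
    lp X p →L[ℂ] lp X p :=
  rowOp (φ := id) (a := fun n => c n • ContinuousLinearMap.id ℂ (X n)) (K := 1) le_rfl
    (fun t k => Finset.card_le_one.2 fun i hi j hj => by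
      rw [Finset.mem_filter] at hi hj; exact hi.2.trans hj.2.symm) hs (norm_smul_id_le hc) p

@[simp]
theorem diagOp_apply {c : κ → ℂ} {s : ℝ} (hs : 0 ≤ s) (hc : ∀ n, ‖c n‖ ≤ s) (p : ℝ≥0∞)
    [Fact (1 ≤ p)] (x : lp X p) (n : κ) : diagOp hs hc p x n = c n • x n := rfl

theorem diagOp_diagOp_of_mul_eq_one {c c' : κ → ℂ} {s s' : ℝ} (hs : 0 ≤ s) (hc : ∀ n, ‖c n‖ ≤ s)
    (hs' : 0 ≤ s') (hc' : ∀ n, ‖c' n‖ ≤ s') (h : ∀ n, c n * c' n = 1) (p : ℝ≥0∞)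
    [Fact (1 ≤ p)] (x : lp X p) : diagOp hs hc p (diagOp hs' hc' p x) = x :=
  lp.ext <| funext fun n => by rw [diagOp_apply, diagOp_apply, smul_smul, h, one_smul]

end DiagOperator

/-! ### Matrices dominated by a summable sequence of diagonals -/

section MatrixOperator

variable {ι G : Type*} [AddCommGroup G] [DecidableEq G]
  {X : G → Type*} {Y : ι → Type*}
  [∀ n, NormedAddCommGroup (X n)] [∀ n, NormedSpace ℂ (X n)]
  [∀ n, NormedAddCommGroup (Y n)] [∀ n, NormedSpace ℂ (Y n)]
  {φ : ι → G} {K : ℕ} {s : G → ℝ}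
  {A : ∀ (m : ι) (n : G), X n →L[ℂ] Y m}

theorem card_fiber_sub_le (hφ : ∀ (t : Finset ι) (k : G), (t.filter (φ · = k)).card ≤ K) (k : G)
    (t : Finset ι) (n : G) : (t.filter (φ · - k = n)).card ≤ K := by
  simpa only [sub_eq_iff_eq_add] using hφ t (n + k)

/-- The operator on `ℓ^p` given by the diagonal `φ(m) - n = k` of a matrix. -/
def diagonalOp (hK : 1 ≤ K) (hφ : ∀ (t : Finset ι) (k : G), (t.filter (φ · = k)).card ≤ K)
    (hs : ∀ k, 0 ≤ s k) (hA : ∀ m n, ‖A m n‖ ≤ s (φ m - n)) (p : ℝ≥0∞) [Fact (1 ≤ p)] (k : G) :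
    lp X p →L[ℂ] lp Y p :=
  rowOp (φ := fun m => φ m - k) (a := fun m => A m (φ m - k)) hK (card_fiber_sub_le hφ k) (hs k)
    (fun m => (hA m _).trans_eq (by rw [sub_sub_cancel])) p

variable (hK : 1 ≤ K) (hφ : ∀ (t : Finset ι) (k : G), (t.filter (φ · = k)).card ≤ K)
  (hs : ∀ k, 0 ≤ s k) (hA : ∀ m n, ‖A m n‖ ≤ s (φ m - n)) (p : ℝ≥0∞) [hp : Fact (1 ≤ p)]

@[simp]
theorem diagonalOp_apply (k : G) (x : lp X p) (m : ι) :
    diagonalOp hK hφ hs hA p k x m = A m (φ m - k) (x (φ m - k)) := rfl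

theorem norm_diagonalOp_le (k : G) : ‖diagonalOp hK hφ hs hA p k‖ ≤ K * s k :=
  norm_rowOp_le _ _ _ _ _

variable (hsum : Summable s)
include hsum

variable [∀ m, CompleteSpace (Y m)]

theorem summable_diagonalOp : Summable (diagonalOp hK hφ hs hA p) :=
  Summable.of_norm_bounded (hsum.mul_left (K : ℝ)) (norm_diagonalOp_le hK hφ hs hA p)

/-- A matrix that is dominated by a summable sequence of diagonals defines a bounded operator on
every `ℓ^p`. -/
theorem exists_clm_hasSum : ∃ T : lp X p →L[ℂ] lp Y p, HasSum (diagonalOp hK hφ hs hA p) T ∧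
    ‖T‖ ≤ K * ∑' k, s k ∧ ∀ (x : lp X p) (m : ι), HasSum (fun n => A m n (x n)) (T x m) := by
  have h := (summable_diagonalOp hK hφ hs hA p hsum).hasSum
  refine ⟨_, h, ?_, fun x m => ?_⟩
  · exact tsum_of_norm_bounded (hsum.hasSum.mul_left (K : ℝ)) (norm_diagonalOp_le hK hφ hs hA p)
  · have h1 := h.mapL ((lp.evalCLM ℂ Y p m).comp (ContinuousLinearMap.apply ℂ (lp Y p) x))
    exact (Equiv.subLeft (φ m)).hasSum_iff.1 h1

omit [DecidableEq G] [∀ m, CompleteSpace (Y m)] in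
theorem summable_norm_row (hA : ∀ m n, ‖A m n‖ ≤ s (φ m - n)) (m : ι) : Summable fun n => ‖A m n‖ :=
  ((Equiv.subLeft (φ m)).summable_iff.2 hsum).of_nonneg_of_le (fun _ => norm_nonneg _) (hA m)

omit [DecidableEq G] [∀ m, CompleteSpace (Y m)] in
theorem tsum_norm_row_le (hA : ∀ m n, ‖A m n‖ ≤ s (φ m - n)) (m : ι) :
    ∑' n, ‖A m n‖ ≤ ∑' k, s k := by
  rw [← (Equiv.subLeft (φ m)).tsum_eq s]
  exact (summable_norm_row hsum hA m).tsum_le_tsum (hA m)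
    ((Equiv.subLeft (φ m)).summable_iff.2 hsum)

end MatrixOperator

/-! ### The matrix of the inverse -/

theorem summable_prod_mul {ι κ : Type*} {a : κ → ℝ} (ha0 : ∀ n, 0 ≤ a n) (ha : Summable a)
    {b : κ → ι → ℝ} (hb0 : ∀ n m, 0 ≤ b n m) (hb : ∀ n, Summable (b n)) {C : ℝ}
    (hC : ∀ n, ∑' m, b n m ≤ C) : Summable fun i : κ × ι => a i.1 * b i.1 i.2 := by
  have h0 : ∀ i : κ × ι, 0 ≤ a i.1 * b i.1 i.2 := fun i => mul_nonneg (ha0 _) (hb0 _ _)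
  rw [summable_prod_of_nonneg h0]
  refine ⟨fun n => (hb n).mul_left (a n), ?_⟩
  refine (ha.mul_right C).of_nonneg_of_le (fun n => tsum_nonneg fun m => h0 (n, m)) fun n => ?_
  dsimp only
  rw [tsum_mul_left]
  exact mul_le_mul_of_nonneg_left (hC n) (ha0 n)

section Inverse

variable {ι κ : Type*} [DecidableEq ι] [DecidableEq κ] {X : κ → Type*} {Y : ι → Type*}
  [∀ n, NormedAddCommGroup (X n)] [∀ n, NormedSpace ℂ (X n)]
  [∀ n, NormedAddCommGroup (Y n)] [∀ n, NormedSpace ℂ (Y n)]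

omit [DecidableEq κ] in
/-- If `A B = 1` as matrices, then `A (B y) = y` for bounded `y`. -/
theorem eq_of_hasSum_of_mul_eq_one {A : ∀ (m : ι) (n : κ), X n →L[ℂ] Y m}
    {B : ∀ (n : κ) (m : ι), Y m →L[ℂ] X n} {m : ι} (hA : Summable fun n => ‖A m n‖)
    [CompleteSpace (Y m)]
    (hB : ∀ n, Summable fun m => ‖B n m‖) {C : ℝ} (hBC : ∀ n, ∑' m, ‖B n m‖ ≤ C)
    (hAB : ∀ (m' : ι) (y : Y m'), HasSum (fun n => A m n (B n m' y)) (Pi.single m' y m))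
    {x : ∀ n, X n} {y : ∀ m, Y m} {D : ℝ} (hy : ∀ m, ‖y m‖ ≤ D)
    (hx : ∀ n, HasSum (fun m => B n m (y m)) (x n)) {z : Y m}
    (hz : HasSum (fun n => A m n (x n)) z) : z = y m := by
  have hD : 0 ≤ D := (norm_nonneg _).trans (hy m)
  -- Absolute summability of the double family allows both orders of summation. No density of
  -- finitely supported vectors is used, so `ℓ^∞` is covered.
  have hF : Summable fun i : κ × ι => A m i.1 (B i.1 i.2 (y i.2)) := by
    have hG : Summable fun i : κ × ι => ‖A m i.1‖ * ‖B i.1 i.2‖ * D :=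
      (summable_prod_mul (fun n => norm_nonneg (A m n)) hA (fun n m => norm_nonneg (B n m)) hB
        hBC).mul_right D
    refine Summable.of_norm_bounded hG fun i => ?_
    rw [mul_assoc]
    exact (A m i.1).le_opNorm_of_le ((B i.1 i.2).le_opNorm_of_le (hy i.2))
  have h1 : HasSum (fun n => A m n (x n)) _ :=
    hF.hasSum.prod_fiberwise fun n => (hx n).mapL (A m n)
  have h2 : HasSum (fun m' => (Pi.single m' (y m') m : Y m)) _ :=
    ((Equiv.prodComm ι κ).hasSum_iff.2 hF.hasSum).prod_fiberwise fun m' => hAB m' (y m')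
  have h3 : HasSum (fun m' => (Pi.single m' (y m') m : Y m)) (y m) := by
    convert hasSum_single m fun m' hm' => Pi.single_eq_of_ne hm'.symm (y m')
    exact (Pi.single_eq_same m (y m)).symm
  rw [hz.unique h1, h2.unique h3]

/-- The matrix of an operator between `ℓ^p` spaces. -/
def opEntry {p : ℝ≥0∞} [Fact (1 ≤ p)] (S : lp Y p →L[ℂ] lp X p) (n : κ) (m : ι) :
    Y m →L[ℂ] X n :=
  (lp.evalCLM ℂ X p n).comp (S.comp (lp.singleContinuousLinearMap ℂ Y p m))

omit [DecidableEq κ] in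
theorem opEntry_apply {p : ℝ≥0∞} [Fact (1 ≤ p)] (S : lp Y p →L[ℂ] lp X p) (n : κ) (m : ι)
    (y : Y m) : opEntry S n m y = S (lp.single p m y) n := rfl

variable {A : ∀ (m : ι) (n : κ), X n →L[ℂ] Y m} {p : ℝ≥0∞} [Fact (1 ≤ p)]
  {T : lp X p ≃L[ℂ] lp Y p}
  (hT : ∀ (x : lp X p) (m : ι), HasSum (fun n => A m n (x n)) (T x m))
include hT

omit [DecidableEq κ] in
theorem hasSum_mul_opEntry_symm (m m' : ι) (y : Y m') :
    HasSum (fun n => A m n (opEntry (T.symm : lp Y p →L[ℂ] lp X p) n m' y)) (Pi.single m' y m) := by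
  have := hT (T.symm (lp.single p m' y)) m
  rw [T.apply_symm_apply] at this
  exact this

omit [DecidableEq ι] in
theorem apply_single_eq (m : ι) (n : κ) (x : X n) : T (lp.single p n x) m = A m n x := by
  refine (hT _ m).unique ?_
  convert hasSum_single n fun n' hn' => ?_
  · simp
  · simp [Pi.single_eq_of_ne hn']

/-- A summable column of `A` is the norm-convergent sum of its coordinates even in `ℓ^∞`, so the
inverse operator may be applied term by term. Without this summability, an operator on `ℓ^∞` need
not be given by its matrix. -/
theorem hasSum_opEntry_symm_mul (n n' : κ) (x : X n') [∀ m, CompleteSpace (Y m)]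
    (hx : Summable fun m => ‖A m n' x‖) :
    HasSum (fun m => opEntry (T.symm : lp Y p →L[ℂ] lp X p) n m (A m n' x))
      (Pi.single n' x n) := by
  have hp0 : 0 < p := one_pos.trans_le (Fact.out : 1 ≤ p)
  have h1 : Summable fun m => lp.single p m (A m n' x) :=
    Summable.of_norm (by simpa [lp.norm_single hp0] using hx)
  have h2 : ∑' m, lp.single p m (A m n' x) = T (lp.single p n' x) := by
    refine lp.ext <| funext fun m => ?_
    rw [apply_single_eq hT]
    refine (h1.hasSum.mapL (lp.evalCLM ℂ Y p m)).unique ?_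
    convert hasSum_single m fun m' hm' => ?_
    · simp [lp.evalCLM]
    · simp [lp.evalCLM, Pi.single_eq_of_ne hm'.symm]
  have h3 := h1.hasSum.mapL ((lp.evalCLM ℂ X p n).comp (T.symm : lp Y p →L[ℂ] lp X p))
  rw [h2] at h3
  have h4 : (lp.evalCLM ℂ X p n).comp (T.symm : lp Y p →L[ℂ] lp X p) (T (lp.single p n' x)) =
      Pi.single n' x n := by
    change (T.symm (T (lp.single p n' x))) n = _
    rw [T.symm_apply_apply]; rfl
  rw [h4] at h3
  exact h3

end Inverse

/-! ### Uniqueness of Fourier coefficients -/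

section Fourier

variable {d : ℕ}

open UnitAddTorus MeasureTheory

local instance : MeasureSpace UnitAddCircle := ⟨AddCircle.haarAddCircle⟩

local instance : IsProbabilityMeasure (volume : Measure UnitAddCircle) :=
  inferInstanceAs (IsProbabilityMeasure AddCircle.haarAddCircle)

/-- The character of `ℤ^d` given by a point of the torus. -/
def torusChar (t : UnitAddTorus (Fin d)) : AddChar (Fin d → ℤ) ℂ where
  toFun k := mFourier k t
  map_zero_eq_one' := by rw [mFourier_zero]; rfl
  map_add_eq_mul' _ _ := mFourier_add

theorem norm_torusChar (t : UnitAddTorus (Fin d)) (k : Fin d → ℤ) : ‖torusChar t k‖ = 1 := by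
  change ‖mFourier k t‖ = 1
  simp only [mFourier, fourier_apply, ContinuousMap.coe_mk, norm_prod, Circle.norm_coe,
    Finset.prod_const_one]

/-- The characters given by points of the torus turn the hypothesis into an identity between
uniformly convergent Fourier series; pairing with the `l`-th exponential in `L²` extracts the
coefficient. -/
theorem fourier_coeff_unique {c : (Fin d → ℤ) → ℂ} (hc : Summable fun k => ‖c k‖) {l : Fin d → ℤ}
    {z : ℂ} (h : ∀ χ : AddChar (Fin d → ℤ) ℂ, (∀ k, ‖χ k‖ = 1) → ∑' k, χ k * c k = χ l * z) :
    c l = z := by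
  have hsum : Summable fun k => c k • mFourier k := by
    refine Summable.of_norm ?_
    simpa [norm_smul, mFourier_norm] using hc
  have heq : ∑' k, c k • mFourier k = z • mFourier l := by
    ext t
    have h1 := hsum.hasSum.mapL (ContinuousMap.evalCLM ℂ t)
    have h2 := h (torusChar t) (norm_torusChar t)
    simp only [torusChar, AddChar.coe_mk, mul_comm _ (c _), mul_comm _ z] at h2
    exact h1.tsum_eq.symm.trans h2
  let Λ : C(UnitAddTorus (Fin d), ℂ) →L[ℂ] ℂ :=
    (innerSL ℂ (mFourierLp (d := Fin d) 2 l)).comp (ContinuousMap.toLp 2 volume ℂ)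
  have hΛ : ∀ k, Λ (mFourier k) = if l = k then 1 else 0 := fun k =>
    (orthonormal_iff_ite.1 (orthonormal_mFourier (d := Fin d))) l k
  have h1 := hsum.hasSum.mapL Λ
  rw [heq, map_smul, hΛ, if_pos rfl, smul_eq_mul, mul_one] at h1
  refine HasSum.unique ?_ h1
  convert hasSum_single l fun k hk => ?_
  · simp [hΛ]
  · simp [hΛ, hk.symm]

end Fourier

/-! ### Decay of the inverse: GRS weights -/

/-- Wiener's lemma for an operator `T = ∑ₖ Dₖ` between two Banach spaces, where the `Dₖ` are
homogeneous of degree `k` for a pair of modulation representations of the dual group. -/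
theorem exists_hasSum_symm_of_homogeneous {G E F : Type*} [AddCommGroup G] [DecidableEq G]
    [NormedAddCommGroup E] [NormedSpace ℂ E] [CompleteSpace E]
    [NormedAddCommGroup F] [NormedSpace ℂ F]
    {w : G → ℝ} (hw : IsBeurling w)
    (hGRS : ∀ n, Filter.Tendsto (fun m : ℕ => w (m • n) ^ (1 / (m : ℝ))) Filter.atTop (𝓝 1))
    (T : E ≃L[ℂ] F) {D : G → E →L[ℂ] F} (hD : HasSum D (T : E →L[ℂ] F))
    (hDw : Summable fun k => ‖D k‖ * w k)
    (hmod : ∀ χ : AddChar G ℂ, (∀ k, ‖χ k‖ = 1) →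
      ∃ (P P' : E →L[ℂ] E) (Q Q' : F →L[ℂ] F), (∀ x, P (P' x) = x) ∧ (∀ x, P' (P x) = x) ∧
        (∀ y, Q (Q' y) = y) ∧ (∀ y, Q' (Q y) = y) ∧ ∀ k x, Q (D k (P' x)) = χ k • D k x) :
    ∃ g : G → F →L[ℂ] E, (Summable fun k => ‖g k‖ * w k) ∧
      ∀ χ : AddChar G ℂ, (∀ k, ‖χ k‖ = 1) → ∀ (P P' : E →L[ℂ] E) (Q Q' : F →L[ℂ] F),
        (∀ x, P (P' x) = x) → (∀ x, P' (P x) = x) →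
        (∀ y, Q (Q' y) = y) → (∀ y, Q' (Q y) = y) →
        (∀ k x, Q (D k (P' x)) = χ k • D k x) →
        ∀ y, HasSum (fun k => χ k • g k y) (P (T.symm (Q' y))) := by
  let S : F →L[ℂ] E := T.symm
  have hTS : ∀ y, T (S y) = y := T.apply_symm_apply
  have hST : ∀ x, S (T x) = x := T.symm_apply_apply
  -- Composing with `T⁻¹` moves the coefficients into the Banach algebra of operators on `E`. The
  -- series at `χ` is then `S Q T P'`, with two-sided inverse `P S Q' T`.
  have hf : Summable fun k => ‖S.comp (D k)‖ * w k := by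
    refine (hDw.mul_left ‖S‖).of_nonneg_of_le
      (fun k => mul_nonneg (norm_nonneg (S.comp (D k))) (hw.pos k).le) fun k => ?_
    rw [← mul_assoc]
    exact mul_le_mul_of_nonneg_right (ContinuousLinearMap.opNorm_comp_le _ _) (hw.pos k).le
  have hfsum : ∀ χ : AddChar G ℂ, (∀ k, ‖χ k‖ = 1) → ∀ (P' : E →L[ℂ] E) (Q : F →L[ℂ] F),
      (∀ k x, Q (D k (P' x)) = χ k • D k x) → ∀ x,
      (∑' k, χ k • S.comp (D k)) x = S (Q (T (P' x))) := by
    intro χ hχ P' Q h x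
    have h1 := (summable_char_smul hw hf hχ).hasSum.mapL (ContinuousLinearMap.apply ℂ E x)
    have h2 := hD.mapL ((S.comp Q).comp (ContinuousLinearMap.apply ℂ F (P' x)))
    refine h1.unique ?_
    convert h2 using 1
    · funext k
      change χ k • S (D k x) = S (Q (D k (P' x)))
      rw [h, map_smul]
    · rfl
  have hinv : ∀ χ : AddChar G ℂ, (∀ k, ‖χ k‖ = 1) → ∀ (P P' : E →L[ℂ] E) (Q Q' : F →L[ℂ] F),
      (∀ x, P (P' x) = x) → (∀ x, P' (P x) = x) →
      (∀ y, Q (Q' y) = y) → (∀ y, Q' (Q y) = y) →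
      (∀ k x, Q (D k (P' x)) = χ k • D k x) →
      (P.comp (S.comp (Q'.comp (T : E →L[ℂ] F)))) * (∑' k, χ k • S.comp (D k)) = 1 ∧
      (∑' k, χ k • S.comp (D k)) * (P.comp (S.comp (Q'.comp (T : E →L[ℂ] F)))) = 1 := by
    intro χ hχ P P' Q Q' hP hP' hQ hQ' h
    constructor
    · ext1 x
      change P (S (Q' (T ((∑' k, χ k • S.comp (D k)) x)))) = x
      rw [hfsum χ hχ P' Q h, hTS, hQ', hST, hP]
    · ext1 x
      change (∑' k, χ k • S.comp (D k)) (P (S (Q' (T x)))) = x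
      rw [hfsum χ hχ P' Q h, hP', hTS, hQ, hST]
  obtain ⟨g, hg, hgF⟩ := exists_leftInverse_of_forall_char hw hf hGRS fun χ hχ => by
    obtain ⟨P, P', Q, Q', hP, hP', hQ, hQ', h⟩ := hmod χ hχ
    exact ⟨_, (hinv χ hχ P P' Q Q' hP hP' hQ hQ' h).1⟩
  refine ⟨fun k => (g k).comp S, ?_, ?_⟩
  · refine (hg.mul_left ‖S‖).of_nonneg_of_le
      (fun k => mul_nonneg (norm_nonneg ((g k).comp S)) (hw.pos k).le) fun k => ?_
    rw [← mul_assoc, mul_comm ‖S‖]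
    exact mul_le_mul_of_nonneg_right (ContinuousLinearMap.opNorm_comp_le _ _) (hw.pos k).le
  · intro χ hχ P P' Q Q' hP hP' hQ hQ' h y
    -- The left inverse supplied by Wiener's lemma must coincide with the known inverse `P S Q' T`;
    -- composing with `S` on the right removes `T`.
    have h1 := left_inv_eq_right_inv (hgF χ hχ) (hinv χ hχ P P' Q Q' hP hP' hQ hQ' h).2
    have h2 := (summable_char_smul hw hg hχ).hasSum.mapL (ContinuousLinearMap.apply ℂ E (S y))
    rw [h1] at h2
    have h3 : (P.comp (S.comp (Q'.comp (T : E →L[ℂ] F)))) (S y) = P (S (Q' y)) := by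
      change P (S (Q' (T (S y)))) = _
      rw [hTS]
    exact h3 ▸ h2

/-! ### Modulations and the entries of the inverse -/

section InverseProfile

/-- Modulation by a unitary character along a map to the group. -/
def modOp {G κ : Type*} [AddCommGroup G] {Z : κ → Type*} [∀ n, NormedAddCommGroup (Z n)]
    [∀ n, NormedSpace ℂ (Z n)] (θ : κ → G) {χ : AddChar G ℂ} (hχ : ∀ k, ‖χ k‖ = 1) (p : ℝ≥0∞)
    [Fact (1 ≤ p)] : lp Z p →L[ℂ] lp Z p :=
  diagOp (c := fun n => χ (θ n)) zero_le_one (fun n => (hχ (θ n)).le) p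

theorem modOp_apply {G κ : Type*} [AddCommGroup G] {Z : κ → Type*} [∀ n, NormedAddCommGroup (Z n)]
    [∀ n, NormedSpace ℂ (Z n)] (θ : κ → G) {χ : AddChar G ℂ} (hχ : ∀ k, ‖χ k‖ = 1) (p : ℝ≥0∞)
    [Fact (1 ≤ p)] (x : lp Z p) (n : κ) : modOp θ hχ p x n = χ (θ n) • x n := rfl

theorem modOp_neg_modOp {G κ : Type*} [AddCommGroup G] {Z : κ → Type*}
    [∀ n, NormedAddCommGroup (Z n)] [∀ n, NormedSpace ℂ (Z n)] (θ : κ → G) {χ : AddChar G ℂ}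
    (hχ : ∀ k, ‖χ k‖ = 1) (p : ℝ≥0∞) [Fact (1 ≤ p)] (x : lp Z p) :
    modOp (-θ) hχ p (modOp θ hχ p x) = x :=
  diagOp_diagOp_of_mul_eq_one _ _ _ _ (fun n => by
    rw [Pi.neg_apply, ← AddChar.map_add_eq_mul, neg_add_cancel, AddChar.map_zero_eq_one]) p x

theorem modOp_modOp_neg {G κ : Type*} [AddCommGroup G] {Z : κ → Type*}
    [∀ n, NormedAddCommGroup (Z n)] [∀ n, NormedSpace ℂ (Z n)] (θ : κ → G) {χ : AddChar G ℂ}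
    (hχ : ∀ k, ‖χ k‖ = 1) (p : ℝ≥0∞) [Fact (1 ≤ p)] (x : lp Z p) :
    modOp θ hχ p (modOp (-θ) hχ p x) = x := by
  simpa using modOp_neg_modOp (-θ) hχ p x

variable {d : ℕ} {ι : Type*} {X : (Fin d → ℤ) → Type*} {Y : ι → Type*}
  [∀ n, NormedAddCommGroup (X n)] [∀ n, InnerProductSpace ℂ (X n)]
  [∀ n, NormedAddCommGroup (Y n)] [∀ n, NormedSpace ℂ (Y n)]
  {φ : ι → Fin d → ℤ} {K : ℕ} {s w : (Fin d → ℤ) → ℝ}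
  {A : ∀ (m : ι) (n : Fin d → ℤ), X n →L[ℂ] Y m}

/-- On this diagonal `n = φ(m) - k`, so the factors combine to `χ(φ(m)) χ(-n) = χ(k)`. -/
theorem modOp_diagonalOp_modOp (hK : 1 ≤ K)
    (hφ : ∀ (t : Finset ι) (k : Fin d → ℤ), (t.filter (φ · = k)).card ≤ K)
    (hs : ∀ k, 0 ≤ s k) (hA : ∀ m n, ‖A m n‖ ≤ s (φ m - n)) {p : ℝ≥0∞} [Fact (1 ≤ p)]
    {χ : AddChar (Fin d → ℤ) ℂ} (hχ : ∀ k, ‖χ k‖ = 1) (k : Fin d → ℤ) (x : lp X p) :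
    modOp φ hχ p (diagonalOp hK hφ hs hA p k (modOp (-id) hχ p x)) =
      χ k • diagonalOp hK hφ hs hA p k x := by
  refine lp.ext <| funext fun m => ?_
  rw [lp.coeFn_smul, Pi.smul_apply, modOp_apply, diagonalOp_apply, diagonalOp_apply, modOp_apply,
    map_smul, smul_smul, ← AddChar.map_add_eq_mul]
  congr 2
  simp

variable [DecidableEq ι]

theorem opEntry_modOp_conj {p : ℝ≥0∞} [Fact (1 ≤ p)] {χ : AddChar (Fin d → ℤ) ℂ}
    (hχ : ∀ k, ‖χ k‖ = 1) (S : lp Y p →L[ℂ] lp X p) (n : Fin d → ℤ) (m : ι) (y : Y m) :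
    modOp id hχ p (S (modOp (-φ) hχ p (lp.single p m y))) n =
      χ (n - φ m) • opEntry S n m y := by
  have h1 : modOp (-φ) hχ p (lp.single p m y) = χ (-φ m) • lp.single p m y := by
    refine lp.ext <| funext fun m' => ?_
    rw [modOp_apply, lp.coeFn_smul, Pi.smul_apply]
    by_cases h : m' = m
    · subst h; rfl
    · simp [Pi.single_eq_of_ne h]
  rw [h1, map_smul, map_smul, lp.coeFn_smul, Pi.smul_apply, modOp_apply, smul_smul,
    opEntry_apply, sub_eq_neg_add, AddChar.map_add_eq_mul]
  rfl

variable [∀ n, CompleteSpace (X n)] [∀ n, CompleteSpace (Y n)]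

omit [DecidableEq ι] [∀ n, CompleteSpace (X n)] in
theorem hasSum_diagonalOp (hK : 1 ≤ K)
    (hφ : ∀ (t : Finset ι) (k : Fin d → ℤ), (t.filter (φ · = k)).card ≤ K)
    (hs : ∀ k, 0 ≤ s k) (hA : ∀ m n, ‖A m n‖ ≤ s (φ m - n)) (hsum : Summable s)
    {p : ℝ≥0∞} [Fact (1 ≤ p)] (T : lp X p →L[ℂ] lp Y p)
    (hT : ∀ (x : lp X p) (m : ι), HasSum (fun n => A m n (x n)) (T x m)) :
    HasSum (diagonalOp hK hφ hs hA p) T := by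
  obtain ⟨T', h1, -, h3⟩ := exists_clm_hasSum hK hφ hs hA p hsum
  have : T' = T := by
    ext1 x
    exact lp.ext <| funext fun m => (h3 x m).unique (hT x m)
  rwa [this] at h1

/-- The entries of the inverse of a matrix with `w`-summable diagonals are dominated by a
`w`-summable sequence of diagonals, if `w` satisfies the GRS condition. -/
theorem exists_profile_symm (hw : IsBeurling w)
    (hGRS : ∀ n, Filter.Tendsto (fun m : ℕ => w (m • n) ^ (1 / (m : ℝ))) Filter.atTop (𝓝 1))
    (hK : 1 ≤ K) (hφ : ∀ (t : Finset ι) (k : Fin d → ℤ), (t.filter (φ · = k)).card ≤ K)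
    (hs : ∀ k, 0 ≤ s k) (hA : ∀ m n, ‖A m n‖ ≤ s (φ m - n)) (hsum : Summable fun k => s k * w k)
    {p : ℝ≥0∞} [Fact (1 ≤ p)] (T : lp X p ≃L[ℂ] lp Y p)
    (hT : ∀ (x : lp X p) (m : ι), HasSum (fun n => A m n (x n)) (T x m)) :
    ∃ γ : (Fin d → ℤ) → ℝ, (∀ k, 0 ≤ γ k) ∧ (Summable fun k => γ k * w k) ∧
      ∀ n m, ‖opEntry (T.symm : lp Y p →L[ℂ] lp X p) n m‖ ≤ γ (n - φ m) := by
  have hp0 : 0 < p := one_pos.trans_le (Fact.out : 1 ≤ p)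
  have hsum1 : Summable s := hsum.of_nonneg_of_le hs fun k =>
    le_mul_of_one_le_right (hs k) (hw.one_le k)
  have hD := hasSum_diagonalOp hK hφ hs hA hsum1 (T : lp X p →L[ℂ] lp Y p) hT
  have hDw : Summable fun k => ‖diagonalOp hK hφ hs hA p k‖ * w k := by
    refine (hsum.mul_left (K : ℝ)).of_nonneg_of_le
      (fun k => mul_nonneg (norm_nonneg (diagonalOp hK hφ hs hA p k)) (hw.pos k).le) fun k => ?_
    rw [← mul_assoc]
    exact mul_le_mul_of_nonneg_right (norm_diagonalOp_le hK hφ hs hA p k) (hw.pos k).le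
  obtain ⟨g, hg, hgT⟩ := exists_hasSum_symm_of_homogeneous hw hGRS T hD hDw fun χ hχ =>
    ⟨modOp id hχ p, modOp (-id) hχ p, modOp φ hχ p, modOp (-φ) hχ p, modOp_modOp_neg id hχ p,
      modOp_neg_modOp id hχ p, modOp_modOp_neg φ hχ p, modOp_neg_modOp φ hχ p,
      modOp_diagonalOp_modOp hK hφ hs hA hχ⟩
  refine ⟨fun k => ‖g k‖, fun k => norm_nonneg (g k), hg, fun n m => ?_⟩
  refine ContinuousLinearMap.opNorm_le_bound _ (norm_nonneg (g (n - φ m))) fun y => ?_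
  -- The `(n, m)` entry of the modulated inverse is `χ(n - φ(m)) b_{nm}` and also `∑ₖ χ(k)
  -- (gₖ)_{nm}`. Inner products with vectors of `X n` reduce the comparison of coefficients to
  -- scalar series.
  have key : g (n - φ m) (lp.single p m y) n = opEntry (T.symm : lp Y p →L[ℂ] lp X p) n m y := by
    refine ext_inner_left ℂ fun x => ?_
    refine fourier_coeff_unique (c := fun k => inner ℂ x (g k (lp.single p m y) n)) ?_
      fun χ hχ => ?_
    · refine ((hg.of_nonneg_of_le (fun k => norm_nonneg (g k)) fun k =>
        le_mul_of_one_le_right (norm_nonneg (g k)) (hw.one_le k)).mul_left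
          (‖x‖ * ‖y‖)).of_nonneg_of_le (fun k => norm_nonneg _) fun k => ?_
      calc ‖inner ℂ x (g k (lp.single p m y) n)‖ ≤ ‖x‖ * ‖g k (lp.single p m y) n‖ :=
            norm_inner_le_norm _ _
        _ ≤ ‖x‖ * (‖g k‖ * ‖y‖) := by
            refine mul_le_mul_of_nonneg_left ?_ (norm_nonneg x)
            refine (lp.norm_apply_le_norm hp0.ne' _ _).trans ((g k).le_opNorm_of_le ?_)
            rw [lp.norm_single hp0]
        _ = _ := by ring
    · have h1 := (hgT χ hχ _ _ _ _ (modOp_modOp_neg id hχ p) (modOp_neg_modOp id hχ p)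
        (modOp_modOp_neg φ hχ p) (modOp_neg_modOp φ hχ p)
        (modOp_diagonalOp_modOp hK hφ hs hA hχ) (lp.single p m y)).mapL
          ((innerSL ℂ x).comp (lp.evalCLM ℂ X p n))
      have h2 : ((innerSL ℂ x).comp (lp.evalCLM ℂ X p n))
          (modOp id hχ p (T.symm (modOp (-φ) hχ p (lp.single p m y)))) =
          χ (n - φ m) * inner ℂ x (opEntry (T.symm : lp Y p →L[ℂ] lp X p) n m y) := by
        rw [← inner_smul_right]
        exact congrArg (inner ℂ x)
          (opEntry_modOp_conj hχ (T.symm : lp Y p →L[ℂ] lp X p) n m y)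
      rw [h2] at h1
      rw [← h1.tsum_eq]
      refine tsum_congr fun k => ?_
      rw [map_smul]; rfl
  rw [← key]
  refine (lp.norm_apply_le_norm hp0.ne' _ _).trans ((g (n - φ m)).le_opNorm_of_le ?_)
  rw [lp.norm_single hp0]

end InverseProfile

/-! ### Decay of the inverse: exponential decay -/

/-- The maximum norm dominates the mean of the `|k i|`, so the exponential is bounded by a product
of one-dimensional geometric sequences. The rate `c / d` is why `d = 0` is separated. -/
theorem summable_exp_neg_norm {d : ℕ} {c : ℝ} (hc : 0 < c) :
    Summable fun k : Fin d → ℤ => Real.exp (-c * ‖k‖) := by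
  obtain rfl | hd := Nat.eq_zero_or_pos d
  · exact summable_of_hasFiniteSupport (Set.toFinite _)
  have hd' : (0 : ℝ) < d := by exact_mod_cast hd
  let u : ℤ → ℝ := fun j => Real.exp (-(c / d) * |(j : ℝ)|)
  have hu : Summable u := by
    have h1 : Summable fun n : ℕ => Real.exp (-(c / d) * (n : ℝ)) := by
      have := Real.summable_exp_nat_mul_iff.2 (show -(c / d) < 0 by
        have := div_pos hc hd'; linarith)
      exact this.congr fun n => by rw [mul_comm]
    refine Summable.of_nat_of_neg ?_ ?_
    · exact h1.congr fun n => by simp [u]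
    · exact h1.congr fun n => by simp [u]
  have hu0 : ∀ j, 0 ≤ u j := fun j => (Real.exp_pos _).le
  have hle : ∀ k : Fin d → ℤ, Real.exp (-c * ‖k‖) ≤ ∏ i, u (k i) := by
    intro k
    simp only [u]
    rw [← Real.exp_sum, Real.exp_le_exp, ← Finset.mul_sum]
    have : ∑ i, |(k i : ℝ)| ≤ d * ‖k‖ := by
      calc ∑ i, |(k i : ℝ)| ≤ ∑ _i : Fin d, ‖k‖ :=
            Finset.sum_le_sum fun i _ => norm_le_pi_norm k i
        _ = d * ‖k‖ := by simp
    calc -c * ‖k‖ = -(c / d) * (d * ‖k‖) := by field_simp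
      _ ≤ -(c / d) * ∑ i, |(k i : ℝ)| :=
        mul_le_mul_of_nonpos_left this (neg_nonpos.2 (div_pos hc hd').le)
  refine Summable.of_nonneg_of_le (fun k => (Real.exp_pos _).le) hle ?_
  refine summable_of_sum_le (c := (∑' j, u j) ^ d)
    (fun k => Finset.prod_nonneg fun i _ => hu0 _) fun t => ?_
  let b : Finset ℤ := t.biUnion fun k => Finset.univ.image k
  have hsub : t ⊆ Fintype.piFinset fun _ : Fin d => b := by
    intro k hk
    rw [Fintype.mem_piFinset]
    exact fun i => Finset.mem_biUnion.2 ⟨k, hk, Finset.mem_image_of_mem _ (Finset.mem_univ i)⟩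
  calc ∑ k ∈ t, ∏ i, u (k i) ≤ ∑ k ∈ Fintype.piFinset fun _ : Fin d => b, ∏ i, u (k i) :=
        Finset.sum_le_sum_of_subset_of_nonneg hsub fun k _ _ =>
          Finset.prod_nonneg fun i _ => hu0 _
    _ = ∏ _i : Fin d, ∑ j ∈ b, u j := (Finset.prod_univ_sum (fun _ => b) fun _ j => u j).symm
    _ = (∑ j ∈ b, u j) ^ d := by simp
    _ ≤ (∑' j, u j) ^ d := by
        gcongr
        exact hu.sum_le_tsum b fun j _ => hu0 j

theorem abs_exp_sub_one_le_of_abs_le {x y : ℝ} (h : |x| ≤ y) :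
    |Real.exp x - 1| ≤ Real.exp y - 1 := by
  have h1 := Real.exp_le_exp.2 ((le_abs_self x).trans h)
  have h2 := Real.exp_le_exp.2 ((neg_le_neg h).trans (neg_abs_le x))
  have h3 := Real.add_one_le_exp y
  have h4 := Real.add_one_le_exp (-y)
  have h5 : 1 - Real.exp (-y) ≤ Real.exp y - 1 := by
    have : Real.exp y * Real.exp (-y) = 1 := by rw [← Real.exp_add]; simp
    nlinarith [Real.exp_pos y, Real.exp_pos (-y), sq_nonneg (Real.exp y - 1)]
  rw [abs_le]
  constructor <;> linarith

/-- This isolates a small factor `ε / ε₀` at the price of growth `exp(2 ε₀ x)`, which the decay of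
the diagonals can absorb. -/
theorem exp_mul_sub_one_le {ε ε₀ x : ℝ} (hε : 0 ≤ ε) (hε₀ : 0 < ε₀) (h : ε ≤ ε₀) (hx : 0 ≤ x) :
    Real.exp (ε * x) - 1 ≤ ε / ε₀ * Real.exp (2 * ε₀ * x) := by
  have h1 : Real.exp (ε * x) - 1 ≤ ε * x * Real.exp (ε * x) := by
    have h2 := Real.add_one_le_exp (-(ε * x))
    have h3 : Real.exp (ε * x) * Real.exp (-(ε * x)) = 1 := by rw [← Real.exp_add]; simp
    nlinarith [Real.exp_pos (ε * x)]
  have h2 : ε₀ * x ≤ Real.exp (ε₀ * x) := by linarith [Real.add_one_le_exp (ε₀ * x)]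
  have h3 : Real.exp (ε * x) ≤ Real.exp (ε₀ * x) :=
    Real.exp_le_exp.2 (mul_le_mul_of_nonneg_right h hx)
  calc _ ≤ ε * x * Real.exp (ε * x) := h1
    _ = ε / ε₀ * (ε₀ * x * Real.exp (ε * x)) := by field_simp
    _ ≤ ε / ε₀ * (Real.exp (ε₀ * x) * Real.exp (ε₀ * x)) := by gcongr
    _ = _ := by rw [← Real.exp_add]; ring_nf

section Exponential

/-- If `T` is invertible and `T'` is a conjugate of `T` by invertible operators which differs
little from `T`, then the conjugate of the inverse is at most twice as large as the inverse. -/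
theorem norm_conj_symm_le {E F : Type*} [NormedAddCommGroup E] [NormedSpace ℂ E]
    [NormedAddCommGroup F] [NormedSpace ℂ F] (T : E ≃L[ℂ] F) {P P' : E →L[ℂ] E} {Q Q' : F →L[ℂ] F}
    (hP : ∀ x, P (P' x) = x) (hQ : ∀ y, Q' (Q y) = y)
    {R : E →L[ℂ] F} (hR : ∀ x, R x = T x - Q (T (P' x)))
    (hsmall : ‖R‖ * ‖(T.symm : F →L[ℂ] E)‖ ≤ 1 / 2) (y : F) :
    ‖P (T.symm (Q' y))‖ ≤ 2 * ‖(T.symm : F →L[ℂ] E)‖ * ‖y‖ := by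
  let S : F →L[ℂ] E := T.symm
  let S' : F →L[ℂ] E := P.comp (S.comp Q')
  -- A resolvent identity. Since `S'` is already known to be bounded, the term `‖S'‖ / 2` can be
  -- absorbed on the left.
  have h1 : S' = S + S'.comp (R.comp S) := by
    ext1 y
    change P (S (Q' y)) = S y + P (S (Q' (R (S y))))
    have h2 : R (S y) = y - Q (T (P' (S y))) := by
      rw [hR]; congr 1; exact T.apply_symm_apply y
    have h3 : S (Q' (Q (T (P' (S y))))) = P' (S y) := by
      rw [hQ]; exact T.symm_apply_apply _
    rw [h2, map_sub, map_sub, map_sub, h3, hP]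
    abel
  have h2 : ‖S'‖ ≤ ‖S‖ + ‖S'‖ * (1 / 2) := by
    calc ‖S'‖ = ‖S + S'.comp (R.comp S)‖ := by rw [← h1]
      _ ≤ ‖S‖ + ‖S'.comp (R.comp S)‖ := norm_add_le _ _
      _ ≤ ‖S‖ + ‖S'‖ * ‖R.comp S‖ := by gcongr; exact ContinuousLinearMap.opNorm_comp_le _ _
      _ ≤ ‖S‖ + ‖S'‖ * (1 / 2) := by
        gcongr
        exact (ContinuousLinearMap.opNorm_comp_le _ _).trans hsmall
  exact S'.le_of_opNorm_le (by linarith) y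

variable {d : ℕ} {ι : Type*} [DecidableEq ι] {X : (Fin d → ℤ) → Type*} {Y : ι → Type*}
  [∀ n, NormedAddCommGroup (X n)] [∀ n, NormedSpace ℂ (X n)]
  [∀ n, NormedAddCommGroup (Y n)] [∀ n, NormedSpace ℂ (Y n)] [∀ n, CompleteSpace (Y n)]
  {φ : ι → Fin d → ℤ} {K : ℕ} {s : (Fin d → ℤ) → ℝ}
  {A : ∀ (m : ι) (n : Fin d → ℤ), X n →L[ℂ] Y m}

theorem norm_exp_le {u B : ℝ} (h : u ≤ B) : ‖((Real.exp u : ℝ) : ℂ)‖ ≤ Real.exp B := by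
  rw [Complex.norm_real, Real.norm_of_nonneg (Real.exp_pos _).le]
  exact Real.exp_le_exp.2 h

/-- If conjugation by `exp(ψ)` with an `ε`-Lipschitz function `ψ` changes the operator little,
then the entries of the inverse decay with the rate `ε`. -/
theorem norm_opEntry_symm_le_of_small (hK : 1 ≤ K)
    (hφ : ∀ (t : Finset ι) (k : Fin d → ℤ), (t.filter (φ · = k)).card ≤ K)
    (hs : ∀ k, 0 ≤ s k) (hA : ∀ m n, ‖A m n‖ ≤ s (φ m - n)) {p : ℝ≥0∞} [Fact (1 ≤ p)]
    (T : lp X p ≃L[ℂ] lp Y p)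
    (hT : ∀ (x : lp X p) (m : ι), HasSum (fun n => A m n (x n)) (T x m)) {ε : ℝ} (hε : 0 ≤ ε)
    (hsum : Summable fun k => s k * (Real.exp (ε * ‖k‖) - 1))
    (hsmall : K * (∑' k, s k * (Real.exp (ε * ‖k‖) - 1)) *
      ‖(T.symm : lp Y p →L[ℂ] lp X p)‖ ≤ 1 / 2) (n : Fin d → ℤ) (m : ι) :
    ‖opEntry (T.symm : lp Y p →L[ℂ] lp X p) n m‖ ≤
      2 * ‖(T.symm : lp Y p →L[ℂ] lp X p)‖ * Real.exp (-ε * ‖n - φ m‖) := by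
  have hp0 : 0 < p := one_pos.trans_le (Fact.out : 1 ≤ p)
  let B : ℝ := ε * ‖n - φ m‖
  -- The truncation makes `ψ` bounded, so `exp(±ψ)` acts on `ℓ^p`, while keeping `ψ(φ m) = 0` and
  -- the full value `ψ(n) = ε ‖n - φ m‖` at the entry to be estimated.
  let ψ : (Fin d → ℤ) → ℝ := fun k => ε * min ‖k - φ m‖ ‖n - φ m‖
  have hψ0 : ∀ k, 0 ≤ ψ k := fun k => mul_nonneg hε (le_min (norm_nonneg _) (norm_nonneg _))
  have hψB : ∀ k, ψ k ≤ B := fun k => mul_le_mul_of_nonneg_left (min_le_right _ _) hε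
  have hψL : ∀ j k, |ψ j - ψ k| ≤ ε * ‖j - k‖ := by
    intro j k
    rw [← mul_sub, abs_mul, abs_of_nonneg hε]
    refine mul_le_mul_of_nonneg_left ?_ hε
    refine (abs_min_sub_min_le_max _ _ _ _).trans ?_
    rw [sub_self, abs_zero, max_eq_left (abs_nonneg _)]
    refine (abs_norm_sub_norm_le _ _).trans_eq ?_
    rw [sub_sub_sub_cancel_right]
  have hψ0' : ∀ k, -ψ k ≤ B := fun k => by linarith [hψ0 k, hψ0 n, hψB n]
  have hB := (Real.exp_pos B).le
  let P : lp X p →L[ℂ] lp X p := diagOp hB (fun k => norm_exp_le (hψB k)) p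
  let P' : lp X p →L[ℂ] lp X p := diagOp hB (fun k => norm_exp_le (hψ0' k)) p
  let Q : lp Y p →L[ℂ] lp Y p := diagOp hB (fun k => norm_exp_le (hψB (φ k))) p
  let Q' : lp Y p →L[ℂ] lp Y p := diagOp hB (fun k => norm_exp_le (hψ0' (φ k))) p
  have hexp : ∀ u : ℝ, ((Real.exp u : ℝ) : ℂ) * ((Real.exp (-u) : ℝ) : ℂ) = 1 := fun u => by
    rw [← Complex.ofReal_mul, ← Real.exp_add, add_neg_cancel, Real.exp_zero, Complex.ofReal_one]
  have hP : ∀ x, P (P' x) = x :=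
    diagOp_diagOp_of_mul_eq_one _ _ _ _ (fun k => hexp (ψ k)) p
  have hQ : ∀ y, Q' (Q y) = y :=
    diagOp_diagOp_of_mul_eq_one _ _ _ _ (fun k => by rw [mul_comm]; exact hexp (ψ (φ k))) p
  -- The matrix of `T - Q T P'`; the Lipschitz bound on `ψ` controls its scalar factors.
  let A' : ∀ (m : ι) (n : Fin d → ℤ), X n →L[ℂ] Y m := fun i k =>
    ((1 - Real.exp (ψ (φ i) - ψ k) : ℝ) : ℂ) • A i k
  have hA' : ∀ i k, ‖A' i k‖ ≤ s (φ i - k) * (Real.exp (ε * ‖φ i - k‖) - 1) := by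
    intro i k
    rw [norm_smul, Complex.norm_real, mul_comm, Real.norm_eq_abs, abs_sub_comm]
    exact mul_le_mul (hA i k) (abs_exp_sub_one_le_of_abs_le (hψL _ _)) (abs_nonneg _) (hs _)
  have hs' : ∀ k, 0 ≤ s k * (Real.exp (ε * ‖k‖) - 1) := fun k =>
    mul_nonneg (hs k) (sub_nonneg.2 (Real.one_le_exp (by positivity)))
  obtain ⟨R, -, hRn, hR⟩ := exists_clm_hasSum hK hφ hs' hA' p hsum
  have hR' : ∀ x, R x = T x - Q (T (P' x)) := by
    intro x
    refine lp.ext <| funext fun i => (hR x i).unique ?_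
    rw [lp.coeFn_sub, Pi.sub_apply]
    have h1 := (hT x i).sub ((hT (P' x) i).const_smul ((Real.exp (ψ (φ i)) : ℝ) : ℂ))
    refine h1.congr_fun fun k => ?_
    change ((1 - Real.exp (ψ (φ i) - ψ k) : ℝ) : ℂ) • A i k (x k) =
      A i k (x k) - ((Real.exp (ψ (φ i)) : ℝ) : ℂ) •
        A i k (((Real.exp (-ψ k) : ℝ) : ℂ) • x k)
    rw [map_smul, smul_smul, ← Complex.ofReal_mul, ← Real.exp_add, ← sub_eq_add_neg,
      Complex.ofReal_sub, sub_smul, Complex.ofReal_one, one_smul]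
  refine ContinuousLinearMap.opNorm_le_bound _ (by positivity) fun y => ?_
  have h1 := norm_conj_symm_le T hP hQ hR'
    ((mul_le_mul_of_nonneg_right hRn (norm_nonneg _)).trans hsmall) (lp.single p m y)
  have h2 : Q' (lp.single p m y) = lp.single p m y := by
    refine lp.ext <| funext fun i => ?_
    rw [show Q' (lp.single p m y) i =
      ((Real.exp (-ψ (φ i)) : ℝ) : ℂ) • (lp.single p m y : lp Y p) i from rfl]
    by_cases h : i = m
    · subst h
      simp [ψ]
    · simp [Pi.single_eq_of_ne h]
  have h3 := (lp.norm_apply_le_norm hp0.ne' (P (T.symm (Q' (lp.single p m y)))) n).trans h1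
  rw [h2, lp.norm_single hp0] at h3
  change ‖((Real.exp (ψ n) : ℝ) : ℂ) • opEntry (T.symm : lp Y p →L[ℂ] lp X p) n m y‖ ≤ _ at h3
  have h4 : ψ n = ε * ‖n - φ m‖ := by simp [ψ]
  rw [norm_smul, Complex.norm_real, Real.norm_of_nonneg (Real.exp_pos _).le, h4] at h3
  rw [neg_mul, Real.exp_neg, mul_right_comm, ← div_eq_mul_inv, le_div_iff₀ (Real.exp_pos _),
    mul_comm]
  exact h3

/-- The entries of the inverse of a matrix with exponentially decaying diagonals decay
exponentially. -/
theorem exists_exp_decay_symm (hK : 1 ≤ K)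
    (hφ : ∀ (t : Finset ι) (k : Fin d → ℤ), (t.filter (φ · = k)).card ≤ K)
    (hs : ∀ k, 0 ≤ s k) (hA : ∀ m n, ‖A m n‖ ≤ s (φ m - n)) {p : ℝ≥0∞} [Fact (1 ≤ p)]
    (T : lp X p ≃L[ℂ] lp Y p)
    (hT : ∀ (x : lp X p) (m : ι), HasSum (fun n => A m n (x n)) (T x m))
    {C c : ℝ} (hc : 0 < c) (hsc : ∀ k, s k ≤ C * Real.exp (-c * ‖k‖)) :
    ∃ C' ε : ℝ, 0 ≤ C' ∧ 0 < ε ∧ ∀ n m, ‖opEntry (T.symm : lp Y p →L[ℂ] lp X p) n m‖ ≤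
      C' * Real.exp (-ε * ‖n - φ m‖) := by
  have hC : 0 ≤ C := by simpa using (hs 0).trans (hsc 0)
  -- With this choice `-c + 2 ε₀ = -2 ε₀`, so half of the decay survives.
  let ε₀ := c / 4
  have hε₀ : 0 < ε₀ := by positivity
  let L := ∑' k : Fin d → ℤ, Real.exp (-(2 * ε₀) * ‖k‖)
  have hL : Summable fun k : Fin d → ℤ => Real.exp (-(2 * ε₀) * ‖k‖) :=
    summable_exp_neg_norm (by positivity)
  have hL0 : 0 ≤ L := tsum_nonneg fun k => (Real.exp_pos _).le
  let N := K * (C / ε₀ * L) * ‖(T.symm : lp Y p →L[ℂ] lp X p)‖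
  have hN : 0 ≤ N := by positivity
  -- The second bound gives `ε N ≤ 1 / 2`; the summand `1` keeps the denominator positive when `N =
  -- 0`.
  let ε := min ε₀ (1 / (2 * (N + 1)))
  have hε : 0 < ε := lt_min hε₀ (by positivity)
  have hle : ∀ k, s k * (Real.exp (ε * ‖k‖) - 1) ≤
      (ε * (C / ε₀)) * Real.exp (-(2 * ε₀) * ‖k‖) := by
    intro k
    have h1 := exp_mul_sub_one_le hε.le hε₀ (min_le_left _ _) (norm_nonneg k)
    have h0 : 0 ≤ Real.exp (ε * ‖k‖) - 1 := sub_nonneg.2 (Real.one_le_exp (by positivity))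
    calc s k * (Real.exp (ε * ‖k‖) - 1)
        ≤ (C * Real.exp (-c * ‖k‖)) * (ε / ε₀ * Real.exp (2 * ε₀ * ‖k‖)) :=
          mul_le_mul (hsc k) h1 h0 (by positivity)
      _ = (ε * (C / ε₀)) * (Real.exp (-c * ‖k‖) * Real.exp (2 * ε₀ * ‖k‖)) := by ring
      _ = _ := by
          rw [← Real.exp_add]
          congr 2
          simp only [ε₀]; ring
  have h0 : ∀ k, 0 ≤ s k * (Real.exp (ε * ‖k‖) - 1) := fun k =>
    mul_nonneg (hs k) (sub_nonneg.2 (Real.one_le_exp (by positivity)))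
  have hsum := Summable.of_nonneg_of_le h0 hle (hL.mul_left _)
  refine ⟨_, ε, by positivity, hε, norm_opEntry_symm_le_of_small hK hφ hs hA T hT hε.le hsum ?_⟩
  have h1 : ∑' k, s k * (Real.exp (ε * ‖k‖) - 1) ≤ ε * (C / ε₀) * L := by
    rw [← tsum_mul_left]
    exact hsum.tsum_le_tsum hle (hL.mul_left _)
  calc K * (∑' k, s k * (Real.exp (ε * ‖k‖) - 1)) * ‖(T.symm : lp Y p →L[ℂ] lp X p)‖
      ≤ K * (ε * (C / ε₀) * L) * ‖(T.symm : lp Y p →L[ℂ] lp X p)‖ := by gcongr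
    _ = ε * N := by simp only [N]; ring
    _ ≤ 1 / (2 * (N + 1)) * (N + 1) := by
        gcongr
        · exact min_le_right _ _
        · linarith
    _ = 1 / 2 := by field_simp

end Exponential

/-! ### Slants as diagonals -/

section Geometry

variable {d : ℕ}

/-- The position `⌊α m⌋` around which the `m`-th row of an `α`-slanted matrix is concentrated. -/
def slantIndex (α : ℝ) (m : Fin d → ℤ) : Fin d → ℤ := fun k => ⌊α * (m k : ℝ)⌋

theorem forall_mem_Ico_iff_slantIndex_sub (α : ℝ) (m n j : Fin d → ℤ) :
    (∀ k, α * (m k : ℝ) - (n k : ℝ) ∈ Set.Ico (j k : ℝ) ((j k : ℝ) + 1)) ↔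
      slantIndex α m - n = j := by
  rw [funext_iff]
  refine forall_congr' fun k => ?_
  rw [Pi.sub_apply, slantIndex, ← Int.floor_sub_intCast, Int.floor_eq_iff, Set.mem_Ico]

/-- The cube of lattice points with coordinates in `[-N, N]`. -/
def cube (d : ℕ) (N : ℤ) : Finset (Fin d → ℤ) := Finset.Icc (fun _ => -N) fun _ => N

theorem mem_cube {N : ℤ} {n : Fin d → ℤ} : n ∈ cube d N ↔ ∀ k, |n k| ≤ N := by
  simp only [cube, Finset.mem_Icc, Pi.le_def, abs_le, forall_and]

theorem one_le_card_cube {N : ℤ} (hN : 0 ≤ N) : 1 ≤ (cube d N).card :=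
  Finset.card_pos.2 ⟨0, mem_cube.2 fun k => by simpa using hN⟩

theorem abs_sub_le_of_floor_eq {α : ℝ} (hα : α ≠ 0) {a b : ℤ}
    (h : ⌊α * (a : ℝ)⌋ = ⌊α * (b : ℝ)⌋) : |a - b| ≤ ⌈|α⁻¹|⌉ := by
  have h1 : |α * (a : ℝ) - α * b| < 1 := Int.abs_sub_lt_one_of_floor_eq_floor h
  have h2 : ((|a - b| : ℤ) : ℝ) ≤ |α⁻¹| := by
    push_cast
    calc |(a : ℝ) - b| = |α⁻¹| * |α * (a : ℝ) - α * b| := by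
          rw [← abs_mul, mul_sub, inv_mul_cancel_left₀ hα, inv_mul_cancel_left₀ hα]
      _ ≤ |α⁻¹| * 1 := by gcongr
      _ = |α⁻¹| := mul_one _
  exact_mod_cast h2.trans (Int.le_ceil _)

/-- Points of one fibre differ by at most `⌈|α⁻¹|⌉` in each coordinate, so a translate of the fibre
lies in a cube. Only uniform finiteness matters, so the constant is not optimised. -/
theorem card_fiber_slantIndex_le {α : ℝ} (hα : α ≠ 0) (t : Finset (Fin d → ℤ)) (k : Fin d → ℤ) :
    (t.filter (slantIndex α · = k)).card ≤ (cube d ⌈|α⁻¹|⌉).card := by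
  obtain h | ⟨m₀, hm₀⟩ := (t.filter (slantIndex α · = k)).eq_empty_or_nonempty
  · rw [h]; exact Nat.zero_le _
  · refine Finset.card_le_card_of_injOn (fun m => m - m₀) (fun m hm => ?_)
      (sub_left_injective.injOn)
    rw [Finset.mem_coe, Finset.mem_filter] at hm
    rw [Finset.mem_filter] at hm₀
    refine mem_cube.2 fun i => abs_sub_le_of_floor_eq hα ?_
    exact congrFun (hm.2.trans hm₀.2.symm) i

/-- Writing `⌊α m⌋ = α m - {α m}` gives `α⁻¹ (n - ⌊α m⌋) = α⁻¹ n - m + α⁻¹ {α m}`. The error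
consists of two roundings and a term of size at most `|α⁻¹|`. -/
theorem abs_slant_inv_sub_ceil_le {α : ℝ} (hα : α ≠ 0) (n m : ℤ) :
    |(⌊α⁻¹ * (n : ℝ)⌋ - m) - ⌈α⁻¹ * ((n - ⌊α * (m : ℝ)⌋ : ℤ) : ℝ)⌉| ≤ ⌈2 + |α⁻¹|⌉ := by
  have e : α⁻¹ * ((n - ⌊α * (m : ℝ)⌋ : ℤ) : ℝ) =
      α⁻¹ * n - m + α⁻¹ * Int.fract (α * (m : ℝ)) := by
    rw [Int.fract]; push_cast; field_simp; ring
  have hf0 := Int.fract_nonneg (α * (m : ℝ))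
  have hf1 := (Int.fract_lt_one (α * (m : ℝ))).le
  have hf : |α⁻¹ * Int.fract (α * (m : ℝ))| ≤ |α⁻¹| := by
    rw [abs_mul, abs_of_nonneg hf0]
    exact mul_le_of_le_one_right (abs_nonneg _) hf1
  rw [e]
  set x := α⁻¹ * (n : ℝ)
  set y := α⁻¹ * Int.fract (α * (m : ℝ))
  have h1 := Int.floor_le x
  have h2 := Int.lt_floor_add_one x
  have h3 := Int.le_ceil (x - m + y)
  have h4 := Int.ceil_lt_add_one (x - m + y)
  have h5 := abs_le.1 hf
  have h6 : |((⌊x⌋ : ℝ) - m) - (⌈x - m + y⌉ : ℝ)| ≤ 2 + |α⁻¹| := by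
    rw [abs_le]; constructor <;> linarith
  exact_mod_cast h6.trans (Int.le_ceil _)

theorem slantIndex_inv_sub_mem_cube {α : ℝ} (hα : α ≠ 0) (n m : Fin d → ℤ) :
    (slantIndex α⁻¹ n - m) - (fun k => ⌈α⁻¹ * (((n - slantIndex α m) k : ℤ) : ℝ)⌉) ∈
      cube d ⌈2 + |α⁻¹|⌉ :=
  mem_cube.2 fun k => abs_slant_inv_sub_ceil_le hα (n k) (m k)

theorem norm_slantIndex_inv_sub_le {α : ℝ} (hα : α ≠ 0) (n m : Fin d → ℤ) :
    ‖slantIndex α⁻¹ n - m‖ ≤ |α⁻¹| * ‖n - slantIndex α m‖ + (1 + |α⁻¹|) := by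
  rw [pi_norm_le_iff_of_nonneg (by positivity)]
  intro k
  have hl : |(((n - slantIndex α m) k : ℤ) : ℝ)| ≤ ‖n - slantIndex α m‖ :=
    norm_le_pi_norm (n - slantIndex α m) k
  have e : α⁻¹ * (n k : ℝ) - m k =
      α⁻¹ * ((((n - slantIndex α m) k : ℤ) : ℝ) - Int.fract (α * (m k : ℝ))) := by
    rw [Int.fract, Pi.sub_apply, slantIndex]; push_cast; field_simp; ring
  have hf0 := Int.fract_nonneg (α * (m k : ℝ))
  have hf1 := (Int.fract_lt_one (α * (m k : ℝ))).le
  have h0 : |α⁻¹ * (n k : ℝ) - m k| ≤ |α⁻¹| * (‖n - slantIndex α m‖ + 1) := by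
    rw [e, abs_mul]
    gcongr
    refine (abs_sub _ _).trans (add_le_add hl ?_)
    rw [abs_of_nonneg hf0]; exact hf1
  have h1 := Int.floor_le (α⁻¹ * (n k : ℝ))
  have h2 := Int.lt_floor_add_one (α⁻¹ * (n k : ℝ))
  have h3 := abs_le.1 h0
  change |((⌊α⁻¹ * (n k : ℝ)⌋ - m k : ℤ) : ℝ)| ≤ _
  push_cast
  rw [abs_le]; constructor <;> linarith

theorem norm_eq_maxAbs (n : Fin d → ℤ) : ‖n‖ = maxAbs n := by
  refine le_antisymm ?_ ?_
  · rw [pi_norm_le_iff_of_nonneg (Nat.cast_nonneg _)]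
    intro k
    rw [Int.norm_eq_abs, ← Int.cast_abs, ← Nat.cast_natAbs, Nat.cast_le]
    exact Finset.le_sup (f := fun k => (n k).natAbs) (Finset.mem_univ k)
  · refine (Nat.cast_le.2 (Finset.sup_le fun k _ => Nat.le_floor ?_)).trans
      (Nat.floor_le (norm_nonneg n))
    rw [Nat.cast_natAbs, Int.cast_abs, ← Int.norm_eq_abs]
    exact norm_le_pi_norm n k

end Geometry

/-! ### The classes `Σ` and `𝓔` in terms of diagonals -/

section Classes

variable {d : ℕ} {X Y : (Fin d → ℤ) → Type*}
  [∀ n, NormedAddCommGroup (X n)] [∀ n, NormedSpace ℂ (X n)]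
  [∀ n, NormedAddCommGroup (Y n)] [∀ n, NormedSpace ℂ (Y n)]
  {α : ℝ} {ω : (Fin d → ℤ) → ℝ} {A : OpMatrix X Y}

open Classical in
theorem slant_apply (α : ℝ) (A : OpMatrix X Y) (j m n : Fin d → ℤ) :
    slant α A j m n = if slantIndex α m - n = j then A m n else 0 := by
  simp only [slant, forall_mem_Ico_iff_slantIndex_sub]

theorem enorm_le_supNorm_slant (α : ℝ) (A : OpMatrix X Y) (m n : Fin d → ℤ) :
    ‖A m n‖ₑ ≤ supNorm (slant α A (slantIndex α m - n)) := by
  refine le_trans ?_ (le_iSup₂ (f := fun m' n' =>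
    ‖slant α A (slantIndex α m - n) m' n'‖ₑ) m n)
  rw [slant_apply, if_pos rfl]

theorem supNorm_slant_le {j : Fin d → ℤ} {c : ℝ≥0∞}
    (h : ∀ m n, slantIndex α m - n = j → ‖A m n‖ₑ ≤ c) : supNorm (slant α A j) ≤ c := by
  refine iSup₂_le fun m n => ?_
  rw [slant_apply]
  split_ifs with hj
  · exact h m n hj
  · exact (enorm_zero (E := X n →L[ℂ] Y m)).trans_le zero_le

theorem slant_slant_self (α : ℝ) (A : OpMatrix X Y) (j : Fin d → ℤ) :
    slant α (slant α A j) j = slant α A j := by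
  funext m n
  rw [slant_apply, slant_apply]
  split_ifs <;> rfl

theorem supNorm_slant_slant_of_ne (α : ℝ) (A : OpMatrix X Y) {i j : Fin d → ℤ} (h : i ≠ j) :
    supNorm (slant α (slant α A j) i) = 0 := by
  refine le_antisymm (supNorm_slant_le fun m n hmn => ?_) bot_le
  rw [slant_apply, if_neg (fun h' => h (hmn.symm.trans h'))]
  exact (enorm_zero (E := X n →L[ℂ] Y m)).le

theorem sigmaNorm_one_slant (α : ℝ) (A : OpMatrix X Y) (j : Fin d → ℤ) :
    sigmaNorm α (fun _ => 1) (slant α A j) =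
      ((⌈|α⁻¹|⌉₊ ^ d : ℕ) : ℝ≥0∞) * supNorm (slant α A j) := by
  rw [sigmaNorm, tsum_eq_single j fun i hi => by rw [supNorm_slant_slant_of_ne α A hi, zero_mul],
    slant_slant_self, ENNReal.ofReal_one, mul_one]

theorem one_le_sigmaConst (hα : α ≠ 0) : (1 : ℝ≥0∞) ≤ ((⌈|α⁻¹|⌉₊ ^ d : ℕ) : ℝ≥0∞) := by
  have : 1 ≤ ⌈|α⁻¹|⌉₊ ^ d :=
    Nat.one_le_pow _ _ (Nat.ceil_pos.2 (abs_pos.2 (inv_ne_zero hα)))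
  exact_mod_cast this

theorem MemSigma.tsum_ne_top (hα : α ≠ 0) (hA : MemSigma α ω A) :
    ∑' j, supNorm (slant α A j) * ENNReal.ofReal (ω j) ≠ ∞ :=
  ((le_mul_of_one_le_left zero_le (one_le_sigmaConst hα)).trans_lt hA).ne

theorem memSigma_of_tsum_ne_top
    (h : ∑' j, supNorm (slant α A j) * ENNReal.ofReal (ω j) ≠ ∞) : MemSigma α ω A :=
  ENNReal.mul_lt_top (ENNReal.natCast_lt_top _) h.lt_top

theorem MemSigma.mono {ω' : (Fin d → ℤ) → ℝ} (hA : MemSigma α ω A) (h : ∀ n, ω' n ≤ ω n) :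
    MemSigma α ω' A := by
  refine lt_of_le_of_lt ?_ hA
  unfold sigmaNorm
  gcongr with j
  exact h j

/-- The sequence of the norms of the slants. -/
def profile (α : ℝ) (A : OpMatrix X Y) (k : Fin d → ℤ) : ℝ := (supNorm (slant α A k)).toReal

theorem profile_nonneg (α : ℝ) (A : OpMatrix X Y) (k : Fin d → ℤ) : 0 ≤ profile α A k :=
  ENNReal.toReal_nonneg

theorem MemSigma.supNorm_ne_top (hα : α ≠ 0) (hω : IsWeight ω) (hA : MemSigma α ω A)
    (k : Fin d → ℤ) : supNorm (slant α A k) ≠ ∞ := by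
  refine ne_top_of_le_ne_top (ENNReal.ne_top_of_tsum_ne_top (hA.tsum_ne_top hα) k) ?_
  refine le_mul_of_one_le_right zero_le ?_
  rw [← ENNReal.ofReal_one]
  exact ENNReal.ofReal_le_ofReal (hω k)

theorem MemSigma.norm_le_profile (hα : α ≠ 0) (hω : IsWeight ω) (hA : MemSigma α ω A)
    (m n : Fin d → ℤ) : ‖A m n‖ ≤ profile α A (slantIndex α m - n) := by
  rw [← toReal_enorm]
  exact ENNReal.toReal_mono (hA.supNorm_ne_top hα hω _) (enorm_le_supNorm_slant α A m n)

theorem MemSigma.summable_profile_mul (hα : α ≠ 0) (hω : IsWeight ω) (hA : MemSigma α ω A) :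
    Summable fun k => profile α A k * ω k := by
  refine (ENNReal.summable_toReal (hA.tsum_ne_top hα)).congr fun k => ?_
  rw [ENNReal.toReal_mul, ENNReal.toReal_ofReal (zero_le_one.trans (hω k)), profile]

theorem MemSigma.summable_profile (hα : α ≠ 0) (hω : IsWeight ω) (hA : MemSigma α ω A) :
    Summable (profile α A) :=
  (hA.summable_profile_mul hα hω).of_nonneg_of_le (profile_nonneg α A) fun k =>
    le_mul_of_one_le_right (profile_nonneg α A k) (hω k)

/-- A matrix with entries dominated along the diagonals `n - ⌊α m⌋` by an `ω`-summable sequence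
belongs to the class `Σ^ω` for the slope `α⁻¹`. -/
theorem memSigma_inv_of_norm_le (hα : α ≠ 0) (hω : IsAdmissible ω) (hdil : IsDilationBounded α⁻¹ ω)
    {γ : (Fin d → ℤ) → ℝ} (hγ : Summable fun k => γ k * ω k)
    (hA : ∀ n m, ‖A n m‖ ≤ γ (n - slantIndex α m)) : MemSigma α⁻¹ ω A := by
  classical
  obtain ⟨hω1, -, C, hC, hsub⟩ := hω
  obtain ⟨D, hD⟩ := hdil
  let c : (Fin d → ℤ) → Fin d → ℤ := fun l k => ⌈α⁻¹ * (l k : ℝ)⌉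
  let N : Finset (Fin d → ℤ) := cube d ⌈2 + |α⁻¹|⌉
  have hω0 : ∀ n, 0 < ω n := fun n => one_pos.trans_le (hω1 n)
  have hcD : ∀ l, ω (c l) ≤ D * ω l := fun l =>
    (div_le_iff₀ (hω0 l)).1 (hD ⟨l, rfl⟩)
  -- An entry with `n - ⌊α m⌋ = l` can only lie in a slant `j = c l + r` with `r` in the fixed
  -- finite cube. Summing over all such `l` and `r` overcounts harmlessly.
  have hsup : ∀ j, supNorm (slant α⁻¹ A j) ≤
      ∑ r ∈ N, ∑' l, if j = c l + r then ENNReal.ofReal (γ l) else 0 := by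
    intro j
    refine supNorm_slant_le fun n m hj => ?_
    have hr : j - c (n - slantIndex α m) ∈ N := by
      rw [← hj]; exact slantIndex_inv_sub_mem_cube hα n m
    calc ‖A n m‖ₑ ≤ ENNReal.ofReal (γ (n - slantIndex α m)) := by
          rw [← ofReal_norm]; exact ENNReal.ofReal_le_ofReal (hA n m)
      _ = if j = c (n - slantIndex α m) + (j - c (n - slantIndex α m)) then
            ENNReal.ofReal (γ (n - slantIndex α m)) else 0 := by
          rw [if_pos (add_sub_cancel _ _).symm]
      _ ≤ ∑' l, if j = c l + (j - c (n - slantIndex α m)) then ENNReal.ofReal (γ l) else 0 :=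
          ENNReal.le_tsum (n - slantIndex α m)
      _ ≤ _ := Finset.single_le_sum
          (f := fun r => ∑' l, if j = c l + r then ENNReal.ofReal (γ l) else 0)
          (fun _ _ => zero_le) hr
  refine memSigma_of_tsum_ne_top (ne_top_of_le_ne_top ?_
    (ENNReal.tsum_le_tsum fun j => mul_le_mul_left (hsup j) (ENNReal.ofReal (ω j))))
  have hterm : ∀ r l, ENNReal.ofReal (γ l) * ENNReal.ofReal (ω (c l + r)) ≤
      ENNReal.ofReal (C * D * ω r) * ENNReal.ofReal (γ l * ω l) := by
    intro r l
    rcases le_or_gt (γ l) 0 with hγl | hγl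
    · rw [ENNReal.ofReal_of_nonpos hγl, zero_mul]; exact zero_le
    have h1 : ω (c l + r) ≤ C * (D * ω l) * ω r :=
      (hsub _ _).trans (mul_le_mul_of_nonneg_right
        (mul_le_mul_of_nonneg_left (hcD l) hC.le) (hω0 r).le)
    have h2 : 0 ≤ C * D * ω r := by
      have h3 := (hω0 (c l)).le.trans (hcD l)
      have := nonneg_of_mul_nonneg_left h3 (hω0 l)
      have := (hω0 r).le
      positivity
    rw [← ENNReal.ofReal_mul hγl.le, ← ENNReal.ofReal_mul h2]
    refine ENNReal.ofReal_le_ofReal ?_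
    calc γ l * ω (c l + r) ≤ γ l * (C * (D * ω l) * ω r) := by gcongr
      _ = _ := by ring
  -- After exchanging sums, each pair `(l, r)` meets exactly one `j`; injectivity of `c` is not
  -- needed.
  have heq : ∑' j, (∑ r ∈ N, ∑' l, if j = c l + r then ENNReal.ofReal (γ l) else 0) *
      ENNReal.ofReal (ω j) =
      ∑ r ∈ N, ∑' l, ENNReal.ofReal (γ l) * ENNReal.ofReal (ω (c l + r)) := by
    simp only [Finset.sum_mul, ← ENNReal.tsum_mul_right]
    rw [Summable.tsum_finsetSum fun _ _ => ENNReal.summable]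
    refine Finset.sum_congr rfl fun r _ => ?_
    rw [ENNReal.tsum_comm]
    refine tsum_congr fun l => ?_
    rw [tsum_eq_single (c l + r) fun j hj => by rw [if_neg hj, zero_mul], if_pos rfl]
  rw [heq]
  refine (ENNReal.sum_lt_top.2 fun r _ => ?_).ne
  refine (ENNReal.tsum_le_tsum (hterm r)).trans_lt ?_
  rw [ENNReal.tsum_mul_left]
  exact ENNReal.mul_lt_top ENNReal.ofReal_lt_top hγ.tsum_ofReal_lt_top

theorem MemExp.exists_profile_le (hα : α ≠ 0) (hA : MemExp α A) :
    ∃ C c : ℝ, 0 < c ∧ ∀ k, profile α A k ≤ C * Real.exp (-c * ‖k‖) := by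
  obtain ⟨-, C, τ, hτ0, hτ1, h⟩ := hA
  refine ⟨|C|, -Real.log τ, neg_pos.2 (Real.log_neg hτ0 hτ1), fun k => ?_⟩
  have h1 : supNorm (slant α A k) ≤ ENNReal.ofReal (|C| * τ ^ maxAbs k) := by
    calc supNorm (slant α A k) ≤ sigmaNorm α (fun _ => 1) (slant α A k) := by
          rw [sigmaNorm_one_slant]
          exact le_mul_of_one_le_left zero_le (one_le_sigmaConst hα)
      _ ≤ ENNReal.ofReal (C * τ ^ maxAbs k) := h k
      _ ≤ _ := ENNReal.ofReal_le_ofReal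
          (mul_le_mul_of_nonneg_right (le_abs_self C) (by positivity))
  rw [neg_neg, norm_eq_maxAbs, mul_comm (Real.log τ), Real.exp_nat_mul, Real.exp_log hτ0]
  exact ENNReal.toReal_le_of_le_ofReal (by positivity) h1

/-- A matrix with entries decaying exponentially along the diagonals `n - ⌊α m⌋` belongs to the
class `𝓔` for the slope `α⁻¹`. -/
theorem memExp_inv_of_norm_le (hα : α ≠ 0) (hA : MemSigma α⁻¹ (fun _ => 1) A) {C ε : ℝ}
    (hC : 0 ≤ C) (hε : 0 < ε)
    (h : ∀ n m, ‖A n m‖ ≤ C * Real.exp (-ε * ‖n - slantIndex α m‖)) : MemExp α⁻¹ A := by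
  have ha : 0 < |α⁻¹| := abs_pos.2 (inv_ne_zero hα)
  let M : ℕ := ⌈|α⁻¹⁻¹|⌉₊ ^ d
  -- The slant index grows at most like `|α⁻¹| ‖n - ⌊α m⌋‖ + 1 + |α⁻¹|`, so the rate is divided by
  -- `|α⁻¹|` and the additive term enters the constant.
  refine ⟨hA, M * (C * Real.exp (ε / |α⁻¹| * (1 + |α⁻¹|))), Real.exp (-(ε / |α⁻¹|)),
    Real.exp_pos _, Real.exp_lt_one_iff.2 (neg_neg_of_pos (by positivity)), fun j => ?_⟩
  rw [sigmaNorm_one_slant, mul_assoc, ENNReal.ofReal_mul (Nat.cast_nonneg M),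
    ENNReal.ofReal_natCast]
  refine mul_le_mul_right (supNorm_slant_le fun n m hj => ?_) _
  rw [← ofReal_norm]
  refine ENNReal.ofReal_le_ofReal ((h n m).trans ?_)
  rw [mul_assoc, ← Real.exp_nat_mul, ← norm_eq_maxAbs, ← Real.exp_add]
  refine mul_le_mul_of_nonneg_left (Real.exp_le_exp.2 ?_) hC
  have h1 := norm_slantIndex_inv_sub_le hα n m
  rw [hj] at h1
  have h2 := mul_le_mul_of_nonneg_left h1 (div_pos hε ha).le
  have h3 : ε / |α⁻¹| * (|α⁻¹| * ‖n - slantIndex α m‖ + (1 + |α⁻¹|)) =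
      ε * ‖n - slantIndex α m‖ + ε / |α⁻¹| * (1 + |α⁻¹|) := by
    rw [mul_add, ← mul_assoc, div_mul_cancel₀ _ ha.ne']
  rw [h3] at h2
  linarith

/-- Rescaling absorbs the constant `C` into the weight; the maximum with `1` keeps the values at
least `1`. -/
theorem isBeurling_const_mul {C : ℝ} (hω : IsWeight ω)
    (h : ∀ m n, ω (m + n) ≤ C * ω m * ω n) : IsBeurling fun n => max C 1 * ω n where
  one_le k := one_le_mul_of_one_le_of_one_le (le_max_right _ _) (hω k)
  mul i j := by
    have hi := zero_le_one.trans (hω i)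
    have hj := zero_le_one.trans (hω j)
    have hM : 0 ≤ max C 1 := zero_le_one.trans (le_max_right _ _)
    calc max C 1 * ω (i + j) ≤ max C 1 * (C * ω i * ω j) := by gcongr; exact h i j
      _ ≤ max C 1 * (max C 1 * ω i * ω j) := by gcongr; exact le_max_left _ _
      _ = _ := by ring

theorem IsGRS.const_mul {c : ℝ} (hc : 0 < c) (hω : IsWeight ω) (h : IsGRS ω) :
    IsGRS fun n => c * ω n := by
  intro n
  have h1 := tendsto_const_rpow_one_div hc
  have h2 := h1.mul (h n)
  rw [one_mul] at h2
  exact h2.congr fun m => (Real.mul_rpow hc.le (zero_le_one.trans (hω _))).symm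

/-- Two mutually inverse matrices of the classes `Σ` for the slopes `α` and `α⁻¹` define mutually
inverse operators on all `ℓ^q`. -/
theorem invertibleOnWithInverse_of_mul_eq_one [∀ n, CompleteSpace (X n)] [∀ n, CompleteSpace (Y n)]
    {B : OpMatrix Y X} (hα : α ≠ 0) (hω : IsWeight ω) (hA : MemSigma α ω A)
    (hB : MemSigma α⁻¹ ω B)
    (hAB : ∀ (m m' : Fin d → ℤ) (y : Y m'),
      HasSum (fun n => A m n (B n m' y)) (Pi.single m' y m))
    (hBA : ∀ (n n' : Fin d → ℤ) (x : X n'),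
      HasSum (fun m => B n m (A m n' x)) (Pi.single n' x n))
    (q : ℝ≥0∞) [hq : Fact (1 ≤ q)] : InvertibleOnWithInverse A B q := by
  have hα' := inv_ne_zero hα
  have hq0 : q ≠ 0 := (one_pos.trans_le hq.out).ne'
  have hAp := hA.norm_le_profile hα hω
  have hBp := hB.norm_le_profile hα' hω
  have hAs := hA.summable_profile hα hω
  have hBs := hB.summable_profile hα' hω
  obtain ⟨S, -, -, hS⟩ := exists_clm_hasSum
    (one_le_card_cube (Int.ceil_nonneg (abs_nonneg α⁻¹))) (card_fiber_slantIndex_le hα)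
    (profile_nonneg α A) hAp q hAs
  obtain ⟨R, -, -, hR⟩ := exists_clm_hasSum
    (one_le_card_cube (Int.ceil_nonneg (abs_nonneg α⁻¹⁻¹))) (card_fiber_slantIndex_le hα')
    (profile_nonneg α⁻¹ B) hBp q hBs
  have hSR : ∀ y, S (R y) = y := fun y => lp.ext <| funext fun m =>
    eq_of_hasSum_of_mul_eq_one (summable_norm_row hAs hAp m) (summable_norm_row hBs hBp)
      (tsum_norm_row_le hBs hBp) (hAB m) (fun k => lp.norm_apply_le_norm hq0 y k) (hR y)
      (hS (R y) m)
  have hRS : ∀ x, R (S x) = x := fun x => lp.ext <| funext fun n =>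
    eq_of_hasSum_of_mul_eq_one (summable_norm_row hBs hBp n) (summable_norm_row hAs hAp)
      (tsum_norm_row_le hAs hAp) (hBA n) (fun k => lp.norm_apply_le_norm hq0 x k) (hS x)
      (hR (S x) n)
  exact ⟨ContinuousLinearEquiv.equivOfInverse S R hRS hSR, hS, hR⟩

end Classes

end Slanted

end

/-! ### The main theorem -/

theorem mainTheorem6 {d : ℕ} (hd : 1 ≤ d) {X Y : (Fin d → ℤ) → Type*}
    [∀ n, NormedAddCommGroup (X n)] [∀ n, InnerProductSpace ℂ (X n)]
    [∀ n, CompleteSpace (X n)]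
    [∀ n, NormedAddCommGroup (Y n)] [∀ n, InnerProductSpace ℂ (Y n)]
    [∀ n, CompleteSpace (Y n)]
    (α : ℝ) (hα : α ≠ 0) (ω : (Fin d → ℤ) → ℝ)
    (hadm : Slanted.IsAdmissible ω) (hbal : Slanted.IsBalanced ω) (hGRS : Slanted.IsGRS ω)
    (hdil : Slanted.IsDilationBounded α⁻¹ ω)
    (A : Slanted.OpMatrix X Y) (hA : Slanted.MemSigma α ω A)
    (p : ℝ≥0∞) [Fact (1 ≤ p)] (hinv : Slanted.InvertibleOn A p) :
    ∃ B : Slanted.OpMatrix Y X,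
      (∀ (q : ℝ≥0∞) [Fact (1 ≤ q)], Slanted.InvertibleOnWithInverse A B q) ∧
      Slanted.MemSigma α⁻¹ ω B ∧
      (Slanted.MemExp α A → Slanted.MemExp α⁻¹ B) := by
  open Slanted in
  obtain ⟨T, hT⟩ := hinv
  obtain ⟨hω, -, C, -, hsub⟩ := id hadm
  have hM : 0 < max C 1 := one_pos.trans_le (le_max_right _ _)
  have hK := one_le_card_cube (d := d) (Int.ceil_nonneg (abs_nonneg α⁻¹))
  have hφ := card_fiber_slantIndex_le (d := d) hα
  have hAp := hA.norm_le_profile hα hω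
  have hs := profile_nonneg α A
  let B : OpMatrix Y X := opEntry (T.symm : lp Y p →L[ℂ] lp X p)
  obtain ⟨γ, -, hγ, hBγ⟩ := exists_profile_symm (isBeurling_const_mul hω hsub)
    (hGRS.const_mul hM hω) hK hφ hs hAp
    (((hA.summable_profile_mul hα hω).mul_left (max C 1)).congr fun k => by ring) T hT
  have hγ' : Summable fun k => γ k * ω k :=
    (hγ.mul_left (max C 1)⁻¹).congr fun k => by field_simp
  have hB : MemSigma α⁻¹ ω B := memSigma_inv_of_norm_le hα hadm hdil hγ' hBγ
  refine ⟨B, fun q _ => ?_, hB, fun hE => ?_⟩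
  · refine invertibleOnWithInverse_of_mul_eq_one hα hω hA hB
      (fun m m' y => hasSum_mul_opEntry_symm hT m m' y)
      (fun n n' x => hasSum_opEntry_symm_mul hT n n' x ?_) q
    -- Whatever `p` is, `A` also acts on `ℓ¹`; the image of a single coordinate vector is a column
    -- of `A`, which is therefore summable.
    obtain ⟨S, -, -, hS⟩ := exists_clm_hasSum hK hφ hs hAp 1 (hA.summable_profile hα hω)
    have h1 := (lp.memℓp (S (lp.single 1 n' x))).summable (by simp)
    refine h1.congr fun m => ?_
    rw [ENNReal.toReal_one, Real.rpow_one]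
    congr 1
    refine (hS (lp.single 1 n' x) m).unique ?_
    convert hasSum_single n' fun k hk => ?_
    · simp
    · simp [Pi.single_eq_of_ne hk]
  · obtain ⟨C', c, hc, hle⟩ := hE.exists_profile_le hα
    obtain ⟨C'', ε, hC'', hε, hdec⟩ := exists_exp_decay_symm hK hφ hs hAp T hT hc hle
    exact memExp_inv_of_norm_le hα (hB.mono hω) hC'' hε hdec
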